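/- Fix $n\ge 0$ and let $S_n$ be the symmetric group on $[n]=\{1,\dots,n\}$, with $\ell(w)$ the number of inversions of $w\in S_n$. Let $S_n[\mathbf q]=\{\mathbf q^\alpha w : w\in S_n,\ \alpha\in\mathbb Z_{\ge0}^{n-1}\}$, where $\mathbf q^\alpha=q_1^{\alpha_1}\cdots q_{n-1}^{\alpha_{n-1}}$, put $\ell(\mathbf q^\alpha w)=\ell(w)+2\sum_i\alpha_i$, and for $i<j$ put $\mathbf q_{ij}=q_iq_{i+1}\cdots q_{j-1}$. Write $s_{ab}$ for the transposition of $a$ and $b$. For $k\in[n-1]$ the cover relation $\lessdot_k^{\mathbf q}$ of the quantum $k$-Bruhat order on $S_n[\mathbf q]$ is: $\mathbf q^\alpha w\lessdot_k^{\mathbf q} y$ if and only if there are positions $i\le k<j$ such that $y=\mathbf q^\alpha ws_{ij}$ or $y=\mathbf q^\alpha\mathbf q_{ij}ws_{ij}$, and $\ell(y)=\ell(\mathbf q^\alpha w)+1$. Let $\mathcal F_n^{\mathbf q}$ be the free monoid on the symbols $\mathbf v_{ab}$ with $a\ne b$ in $[n]$ (the operators), and adjoin a zero element $\mathbf 0$.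 The degree of an element of $\mathcal F_n^{\mathbf q}$ is the number of its operators. For each $k\in[n-1]$, the monoid $\mathcal F_n^{\mathbf q}\cup\{\mathbf 0\}$ acts from the left on $S_n[\mathbf q]\cup\{0\}$ (the rightmost operator acts first): $\mathbf 0$ sends everything to $0$, every operator fixes $0$, and for $u\in S_n$ $$\mathbf v_{ab}\bullet_k \mathbf q^\alpha u=\begin{cases}\mathbf q^\alpha s_{ab}u,& a<b\text{ and }u\lessdot_k^{\mathbf q}s_{ab}u,\\ \mathbf q^\alpha\mathbf q_{ij}s_{ab}u,& a>b,\ u(i)=a,\ u(j)=b,\ i<j\text{ and }u\lessdot_k^{\mathbf q}\mathbf q_{ij}s_{ab}u,\\ 0,&\text{otherwise.}\end{cases}$$ For $\mathbf v,\mathbf v'\in\mathcal F_n^{\mathbf q}\cup\{\mathbf 0\}$ write $\mathbf v\equiv\mathbf v'$ if $\mathbf v\bullet_k x=\mathbf v'\bullet_k x$ for all $x\in S_n[\mathbf q]$ and all $k\in[n-1]$. The degree of an equivalence is the larger of the degrees of its two sides, with $\mathbf 0$ counted as degree $0$. An equivalence $\mathbf v\equiv\mathbf v'$ is non-zero if $\mathbf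 v\not\equiv\mathbf 0$, and it is minimal if the pair $(\mathbf v,\mathbf v')$ does not belong to the congruence on the monoid $\mathcal F_n^{\mathbf q}\cup\{\mathbf 0\}$ generated by all equivalences of smaller degree. **Theorem.** Up to exchanging the two sides, the minimal non-zero equivalences of degree three are exactly the following, where in (i)--(vi) $a<b<c$ are arbitrary elements of $[n]$, and in (vii)--(xiv) $a<b<c<d$ are arbitrary elements of $[n]$: - (i) $\mathbf v_{cb}\mathbf v_{bc}\mathbf v_{ab}\equiv\mathbf v_{ab}\mathbf v_{ca}\mathbf v_{ac}$ - (ii) $\mathbf v_{ac}\mathbf v_{ca}\mathbf v_{bc}\equiv\mathbf v_{bc}\mathbf v_{ab}\mathbf v_{ba}$ - (iii) $\mathbf v_{ba}\mathbf v_{ab}\mathbf v_{ca}\equiv\mathbf v_{ca}\mathbf v_{bc}\mathbf v_{cb}$ - (iv) $\mathbf v_{ba}\mathbf v_{ab}\mathbf v_{bc}\equiv\mathbf v_{bc}\mathbf v_{ca}\mathbf v_{ac}$ - (v) $\mathbf v_{cb}\mathbf v_{bc}\mathbf v_{ca}\equiv\mathbf v_{ca}\mathbf v_{ab}\mathbf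 v_{ba}$ - (vi) $\mathbf v_{ac}\mathbf v_{ca}\mathbf v_{ab}\equiv\mathbf v_{ab}\mathbf v_{bc}\mathbf v_{cb}$ - (vii) $\mathbf v_{db}\mathbf v_{bc}\mathbf v_{ab}\equiv\mathbf v_{ab}\mathbf v_{da}\mathbf v_{ac}$ - (viii) $\mathbf v_{ac}\mathbf v_{cd}\mathbf v_{bc}\equiv\mathbf v_{bc}\mathbf v_{ab}\mathbf v_{bd}$ - (ix) $\mathbf v_{bd}\mathbf v_{da}\mathbf v_{cd}\equiv\mathbf v_{cd}\mathbf v_{bc}\mathbf v_{ca}$ - (x) $\mathbf v_{ca}\mathbf v_{ab}\mathbf v_{da}\equiv\mathbf v_{da}\mathbf v_{cd}\mathbf v_{db}$ - (xi) $\mathbf v_{ca}\mathbf v_{bc}\mathbf v_{cd}\equiv\mathbf v_{cd}\mathbf v_{da}\mathbf v_{bd}$ - (xii) $\mathbf v_{db}\mathbf v_{cd}\mathbf v_{da}\equiv\mathbf v_{da}\mathbf v_{ab}\mathbf v_{ca}$ - (xiii) $\mathbf v_{ac}\mathbf v_{da}\mathbf v_{ab}\equiv\mathbf v_{ab}\mathbf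 v_{bc}\mathbf v_{db}$ - (xiv) $\mathbf v_{bd}\mathbf v_{ab}\mathbf v_{bc}\equiv\mathbf v_{bc}\mathbf v_{cd}\mathbf v_{ac}$ -/

import Mathlib

namespace QuantumBruhat

/-- The set `S_n[q]`: the pair `(α, w)` stands for `q^α w`. Values, positions, the parameter `k` and
the indices of the variables `q_1, …, q_{n-1}` are all shifted down by one. -/
abbrev SnQ (n : ℕ) : Type := (Fin (n - 1) → ℕ) × Equiv.Perm (Fin n)

/-- The number of inversions of a permutation. -/
def invLength {n : ℕ} (w : Equiv.Perm (Fin n)) : ℕ :=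
  (Finset.univ.filter fun p : Fin n × Fin n => p.1 < p.2 ∧ w p.2 < w p.1).card

/-- `ℓ(q^α w) = ℓ(w) + 2 deg q^α`. -/
def qLength {n : ℕ} (x : SnQ n) : ℕ :=
  invLength x.2 + 2 * ∑ t, x.1 t

/-- The exponent vector of `q_{ij} = q_i q_{i+1} ⋯ q_{j-1}`. -/
def qExp {n : ℕ} (i j : Fin n) : Fin (n - 1) → ℕ :=
  fun t => if (i : ℕ) ≤ (t : ℕ) ∧ (t : ℕ) < (j : ℕ) then 1 else 0

/-- The cover relation of the quantum `k`-Bruhat order on `S_n[q]`, extended `q`-multiplicatively: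
`q^α w` is covered by `q^α w s_{ij}` (classical cover) or by `q^α q_{ij} w s_{ij}` (quantum cover),
for positions `i ≤ k < j`, whenever the length goes up by exactly one. -/
def QCover {n : ℕ} (k : Fin (n - 1)) (x y : SnQ n) : Prop :=
  ∃ i j : Fin n, (i : ℕ) ≤ (k : ℕ) ∧ (k : ℕ) < (j : ℕ) ∧
    (y = (x.1, x.2 * Equiv.swap i j) ∨ y = (x.1 + qExp i j, x.2 * Equiv.swap i j)) ∧
    qLength y = qLength x + 1

instance {n : ℕ} (k : Fin (n - 1)) (x y : SnQ n) : Decidable (QCover k x y) := by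
  unfold QCover
  infer_instance

/-- The operator symbols `v_{ab}` with `a ≠ b` in `[n]`. -/
abbrev Op (n : ℕ) : Type := {p : Fin n × Fin n // p.1 ≠ p.2}

/-- The free monoid `F_n^q` on the operator symbols; its elements are the compositions of operators. -/
abbrev Word (n : ℕ) : Type := FreeMonoid (Op n)

/-- The generator `v_{ab}`. -/
def v {n : ℕ} (a b : Fin n) (h : a ≠ b) : Word n := FreeMonoid.of ⟨(a, b), h⟩

/-- The action of a single operator `v_{ab}` on `S_n[q]`; `none` is the element `0` adjoined to
`S_n[q]`. In the quantum case `a > b`, the monomial `q_{ij}`, with `u(i) = a` and `u(j) = b`, is only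
available for `i < j`. -/
def opAct {n : ℕ} (k : Fin (n - 1)) (o : Op n) (x : SnQ n) : Option (SnQ n) :=
  let a := o.1.1
  let b := o.1.2
  let i := x.2.symm a
  let j := x.2.symm b
  if a < b ∧ QCover k x (x.1, Equiv.swap a b * x.2) then
    some (x.1, Equiv.swap a b * x.2)
  else if b < a ∧ i < j ∧ QCover k x (x.1 + qExp i j, Equiv.swap a b * x.2) then
    some (x.1 + qExp i j, Equiv.swap a b * x.2)
  else none

/-- The action of compositions on `S_n[q] ∪ {0}`. The product in `Function.End` is composition of
maps, so that the rightmost operator acts first, and every operator sends `0` to `0`. -/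
def wordAct {n : ℕ} (k : Fin (n - 1)) : Word n →* Function.End (Option (SnQ n)) :=
  FreeMonoid.lift fun o => ((fun x => x.bind (opAct k o)) : Option (SnQ n) → Option (SnQ n))

/-- The action of `F_n^q ∪ {𝟎}`; the zero operator sends everything to `0`. -/
def act {n : ℕ} (k : Fin (n - 1)) : WithZero (Word n) → Option (SnQ n) → Option (SnQ n)
  | none => fun _ => none
  | some w => wordAct k w

/-- Equivalence of elements of `F_n^q ∪ {𝟎}`: the same action on all of `S_n[q]` for all `k`. -/
def Equivalent {n : ℕ} (x y : WithZero (Word n)) : Prop :=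
  ∀ (k : Fin (n - 1)) (u : SnQ n), act k x (some u) = act k y (some u)

/-- The number of operators in an element of `F_n^q ∪ {𝟎}` (none for the zero operator). -/
def degree {n : ℕ} : WithZero (Word n) → ℕ
  | none => 0
  | some w => w.length

/-- The degree of an equivalence `x ≡ y`. -/
def equivDegree {n : ℕ} (x y : WithZero (Word n)) : ℕ := max (degree x) (degree y)

/-- All consequences of the equivalences of degree less than `r`: the congruence of the monoid
`F_n^q ∪ {𝟎}` that they generate. -/
def lowerCon (n r : ℕ) : Con (WithZero (Word n)) :=
  conGen fun x y => Equivalent x y ∧ equivDegree x y < r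

/-- An equivalence is minimal if it is not a consequence of equivalences of lower degree. -/
def IsMinimalEquiv {n : ℕ} (x y : WithZero (Word n)) : Prop :=
  Equivalent x y ∧ ¬ lowerCon n (equivDegree x y) x y

/-- The fourteen families of pairs of compositions of degree three. -/
inductive Listed {n : ℕ} : Word n → Word n → Prop
  | rel_i {a b c : Fin n} (ab : a < b) (bc : b < c) (ac : a < c) :
      Listed (v c b bc.ne' * v b c bc.ne * v a b ab.ne) (v a b ab.ne * v c a ac.ne' * v a c ac.ne)
  | rel_ii {a b c : Fin n} (ab : a < b) (bc : b < c) (ac : a < c) :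
      Listed (v a c ac.ne * v c a ac.ne' * v b c bc.ne) (v b c bc.ne * v a b ab.ne * v b a ab.ne')
  | rel_iii {a b c : Fin n} (ab : a < b) (bc : b < c) (ac : a < c) :
      Listed (v b a ab.ne' * v a b ab.ne * v c a ac.ne') (v c a ac.ne' * v b c bc.ne * v c b bc.ne')
  | rel_iv {a b c : Fin n} (ab : a < b) (bc : b < c) (ac : a < c) :
      Listed (v b a ab.ne' * v a b ab.ne * v b c bc.ne) (v b c bc.ne * v c a ac.ne' * v a c ac.ne)
  | rel_v {a b c : Fin n} (ab : a < b) (bc : b < c) (ac : a < c) :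
      Listed (v c b bc.ne' * v b c bc.ne * v c a ac.ne') (v c a ac.ne' * v a b ab.ne * v b a ab.ne')
  | rel_vi {a b c : Fin n} (ab : a < b) (bc : b < c) (ac : a < c) :
      Listed (v a c ac.ne * v c a ac.ne' * v a b ab.ne) (v a b ab.ne * v b c bc.ne * v c b bc.ne')
  | rel_vii {a b c d : Fin n} (ab : a < b) (bc : b < c) (ac : a < c) (ad : a < d) (bd : b < d)
      (cd : c < d) :
      Listed (v d b bd.ne' * v b c bc.ne * v a b ab.ne) (v a b ab.ne * v d a ad.ne' * v a c ac.ne)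
  | rel_viii {a b c d : Fin n} (ab : a < b) (bc : b < c) (ac : a < c) (ad : a < d) (bd : b < d)
      (cd : c < d) :
      Listed (v a c ac.ne * v c d cd.ne * v b c bc.ne) (v b c bc.ne * v a b ab.ne * v b d bd.ne)
  | rel_ix {a b c d : Fin n} (ab : a < b) (bc : b < c) (ac : a < c) (ad : a < d) (bd : b < d)
      (cd : c < d) :
      Listed (v b d bd.ne * v d a ad.ne' * v c d cd.ne) (v c d cd.ne * v b c bc.ne * v c a ac.ne')
  | rel_x {a b c d : Fin n} (ab : a < b) (bc : b < c) (ac : a < c) (ad : a < d) (bd : b < d)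
      (cd : c < d) :
      Listed (v c a ac.ne' * v a b ab.ne * v d a ad.ne') (v d a ad.ne' * v c d cd.ne * v d b bd.ne')
  | rel_xi {a b c d : Fin n} (ab : a < b) (bc : b < c) (ac : a < c) (ad : a < d) (bd : b < d)
      (cd : c < d) :
      Listed (v c a ac.ne' * v b c bc.ne * v c d cd.ne) (v c d cd.ne * v d a ad.ne' * v b d bd.ne)
  | rel_xii {a b c d : Fin n} (ab : a < b) (bc : b < c) (ac : a < c) (ad : a < d) (bd : b < d)
      (cd : c < d) :
      Listed (v d b bd.ne' * v c d cd.ne * v d a ad.ne') (v d a ad.ne' * v a b ab.ne * v c a ac.ne')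
  | rel_xiii {a b c d : Fin n} (ab : a < b) (bc : b < c) (ac : a < c) (ad : a < d) (bd : b < d)
      (cd : c < d) :
      Listed (v a c ac.ne * v d a ad.ne' * v a b ab.ne) (v a b ab.ne * v b c bc.ne * v d b bd.ne')
  | rel_xiv {a b c d : Fin n} (ab : a < b) (bc : b < c) (ac : a < c) (ad : a < d) (bd : b < d)
      (cd : c < d) :
      Listed (v b d bd.ne * v a b ab.ne * v b c bc.ne) (v b c bc.ne * v c d cd.ne * v a c ac.ne)

end QuantumBruhat

/-!
Describe a permutation by the positions of its letters. Then `v_{ab}` acts as non-zero if and only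
if `a` stands among the first `k` positions, `b` does not, and no letter standing between them
belongs to the open cyclic interval from `a` to `b`; read cyclically, the classical and the quantum
case agree. Along an operator, the letter at the position of `a` moves up cyclically to `b` and the
one at the position of `b` moves down to `a`. Lifted to the universal cover of the cycle, these
motions determine both the resulting permutation and the resulting monomial, and every letter only
moves up or only moves down. Hence two compositions with the same non-zero action involve the same
letters.

If three operators involve more than four letters, one of them is disjoint from the other two and
can be cancelled, and the remaining pairs agree up to order. If they involve at most four letters,
they may be relabelled as `1, …, 4`, and a finite check leaves the listed relations and the
interchanges of neighbouring disjoint operators, which follow from degree two.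

A listed relation is minimal since neighbouring operators in it share a letter, and its two sides
differ both in the first and in the last operator. An equivalence of degree at most two, applied
inside a composition of degree three, keeps the first or the last operator, so it leaves a listed
composition unchanged.
-/

namespace QuantumBruhat

open Equiv

section Inversions

variable {ι : Type*} [DecidableEq ι]

theorem swap_eq_swap_iff {i j i' j' : ι} (h : i ≠ j) :
    swap i j = swap i' j' ↔ i = i' ∧ j = j' ∨ i = j' ∧ j = i' := by
  refine ⟨fun e => ?_, ?_⟩
  · have hi : swap i' j' i = j := by simp [← e]
    have hj : swap i' j' j = i := by simp [← e]
    rw [swap_apply_def] at hi hj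
    grind
  · rintro (⟨rfl, rfl⟩ | ⟨rfl, rfl⟩)
    · rfl
    · exact swap_comm _ _

variable [Fintype ι] {M : Type*} [AddCommMonoid M]

theorem sum_univ_eq_add_add_sum_erase {i j : ι} (h : i ≠ j) (f : ι → M) :
    ∑ t, f t = f i + (f j + ∑ t ∈ (Finset.univ.erase i).erase j, f t) := by
  rw [Finset.add_sum_erase _ _ (by simp [h.symm]), Finset.add_sum_erase _ _ (by simp)]

theorem sum_sum_eq_add_sum_erase {i j : ι} (h : i ≠ j) (g : ι → ι → M) :
    ∑ p, ∑ q, g p q = g i i + g i j + g j i + g j j +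
      ∑ t ∈ (Finset.univ.erase i).erase j, (g t i + g t j + g i t + g j t) +
      ∑ p ∈ (Finset.univ.erase i).erase j, ∑ q ∈ (Finset.univ.erase i).erase j, g p q := by
  simp only [sum_univ_eq_add_add_sum_erase h, Finset.sum_add_distrib]
  abel

variable {n : ℕ} {w : Perm (Fin n)} {i j : Fin n}

theorem invLength_eq_sum (w : Perm (Fin n)) :
    invLength w = ∑ p, ∑ q, if p < q ∧ w q < w p then 1 else 0 := by
  rw [invLength, Finset.card_filter, Fintype.sum_prod_type]

theorem ite_inversions_mul_swap (hij : i < j) (hw : w i < w j) {t : Fin n} (ne_i : t ≠ i)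
    (ne_j : t ≠ j) :
    ((if t < i ∧ w j < w t then 1 else 0) + (if t < j ∧ w i < w t then 1 else 0) +
      (if i < t ∧ w t < w j then 1 else 0) + (if j < t ∧ w t < w i then 1 else 0)) =
    ((if t < i ∧ w i < w t then 1 else 0) + (if t < j ∧ w j < w t then 1 else 0) +
      (if i < t ∧ w t < w i then 1 else 0) + (if j < t ∧ w t < w j then 1 else 0)) +
    2 * if i < t ∧ t < j ∧ w i < w t ∧ w t < w j then 1 else 0 := by
  rcases ne_i.lt_or_gt with hi | hi <;> rcases ne_j.lt_or_gt with hj | hj <;>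
  rcases (w.injective.ne ne_i).lt_or_gt with hwi | hwi <;>
  rcases (w.injective.ne ne_j).lt_or_gt with hwj | hwj <;>
  first
  | (exfalso; order)
  | simp [hi, hj, hwi, hwj, hi.not_gt, hj.not_gt, hwi.not_gt, hwj.not_gt]

theorem invLength_mul_swap (hij : i < j) (hw : w i < w j) :
    invLength (w * swap i j) = invLength w + 1 +
      2 * (Finset.univ.filter fun t => i < t ∧ t < j ∧ w i < w t ∧ w t < w j).card := by
  set T := (Finset.univ.erase i).erase j with hT
  have mem_T {t : Fin n} : t ∈ T ↔ t ≠ i ∧ t ≠ j := by simp [hT, and_comm]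
  have swapped_of_mem {t : Fin n} (ht : t ∈ T) : (w * swap i j) t = w t := by
    rw [mem_T] at ht
    rw [Perm.mul_apply, swap_apply_of_ne_of_ne ht.1 ht.2]
  have card_between : (Finset.univ.filter fun t => i < t ∧ t < j ∧ w i < w t ∧ w t < w j).card =
      ∑ t ∈ T, if i < t ∧ t < j ∧ w i < w t ∧ w t < w j then 1 else 0 := by
    rw [Finset.card_filter, sum_univ_eq_add_add_sum_erase hij.ne]
    simp [hT]
  have inversions_inside : ∑ p ∈ T, ∑ q ∈ T,
      (if p < q ∧ (w * swap i j) q < (w * swap i j) p then 1 else 0) =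
      ∑ p ∈ T, ∑ q ∈ T, if p < q ∧ w q < w p then 1 else 0 :=
    Finset.sum_congr rfl fun p hp => Finset.sum_congr rfl fun q hq => by
      rw [swapped_of_mem hp, swapped_of_mem hq]
  rw [invLength_eq_sum, invLength_eq_sum, sum_sum_eq_add_sum_erase hij.ne,
    sum_sum_eq_add_sum_erase hij.ne, ← hT, inversions_inside, card_between,
    Finset.sum_congr rfl fun t ht => by
      rw [swapped_of_mem ht, Perm.mul_apply, Perm.mul_apply, swap_apply_left, swap_apply_right,
        ite_inversions_mul_swap hij hw (mem_T.1 ht).1 (mem_T.1 ht).2],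
    Finset.sum_add_distrib, ← Finset.mul_sum]
  simp only [Perm.mul_apply, swap_apply_left, swap_apply_right, lt_irrefl, false_and, if_false,
    hij, hij.not_gt, hw, hw.not_gt, true_and, and_false, if_true]
  ring

theorem invLength_mul_swap_of_gt (hij : i < j) (hw : w j < w i) :
    invLength w = invLength (w * swap i j) + 1 +
      2 * (Finset.univ.filter fun t => i < t ∧ t < j ∧ w j < w t ∧ w t < w i).card := by
  have h := invLength_mul_swap (w := w * swap i j) hij (by simpa using hw)
  rw [mul_assoc, swap_mul_self, mul_one] at h
  rw [h]
  congr 3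
  refine Finset.filter_congr fun t _ => and_congr_right fun hit => and_congr_right fun htj => ?_
  simp [swap_apply_of_ne_of_ne hit.ne' htj.ne]

theorem invLength_mul_swap_eq_add_one_iff (hij : i < j) (hw : w i < w j) :
    invLength (w * swap i j) = invLength w + 1 ↔
      ∀ t, i < t → t < j → ¬ (w i < w t ∧ w t < w j) := by
  rw [invLength_mul_swap hij hw, Nat.add_eq_left, Nat.mul_eq_zero, Finset.card_eq_zero,
    Finset.filter_eq_empty_iff]
  simp

theorem invLength_mul_swap_add_eq_add_one_iff (hij : i < j) (hw : w j < w i) :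
    invLength (w * swap i j) + 2 * ((j : ℕ) - i) = invLength w + 1 ↔
      ∀ t, i < t → t < j → w j < w t ∧ w t < w i := by
  set F := Finset.univ.filter fun t => i < t ∧ t < j ∧ w j < w t ∧ w t < w i with hF
  have hsub : F ⊆ Finset.Ioo i j := fun t ht => by
    simp only [hF, Finset.mem_filter] at ht
    exact Finset.mem_Ioo.2 ⟨ht.2.1, ht.2.2.1⟩
  have hcard := Finset.card_le_card hsub
  have card_eq : F.card = (j : ℕ) - i - 1 ↔ Finset.Ioo i j ⊆ F := by
    rw [← Fin.card_Ioo]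
    exact ⟨fun h => (Finset.eq_of_subset_of_card_le hsub h.ge).ge,
      fun h => (hcard.antisymm (Finset.card_le_card h))⟩
  rw [invLength_mul_swap_of_gt hij hw, ← hF]
  rw [Fin.card_Ioo] at hcard
  have : (invLength (w * swap i j) + 2 * ((j : ℕ) - i) =
      invLength (w * swap i j) + 1 + 2 * F.card + 1) ↔ F.card = (j : ℕ) - i - 1 := by omega
  rw [this, card_eq]
  simp [Finset.subset_iff, hF]
  grind

end Inversions

section Covers

variable {n : ℕ} {k : Fin (n - 1)} {α : Fin (n - 1) → ℕ}

theorem qExp_apply_eq_one {i j : Fin n} {t : Fin (n - 1)} (hi : (i : ℕ) ≤ t) (hj : (t : ℕ) < j) :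
    qExp i j t = 1 :=
  if_pos ⟨hi, hj⟩

theorem sum_qExp (i j : Fin n) : ∑ t, qExp i j t = (j : ℕ) - i := by
  unfold qExp
  rw [Fin.sum_univ_eq_sum_range (fun t => if (i : ℕ) ≤ t ∧ t < (j : ℕ) then 1 else 0) (n - 1),
    Finset.sum_boole]
  have : (Finset.range (n - 1)).filter (fun t => (i : ℕ) ≤ t ∧ t < (j : ℕ)) = Finset.Ico ↑i ↑j := by
    ext t
    simp only [Finset.mem_filter, Finset.mem_range, Finset.mem_Ico]
    omega
  rw [this]
  simp

theorem qLength_add_qExp (w w' : Perm (Fin n)) (i j : Fin n) :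
    qLength (α + qExp i j, w') = qLength (α, w) + 1 ↔
      invLength w' + 2 * ((j : ℕ) - i) = invLength w + 1 := by
  simp only [qLength, Pi.add_apply, Finset.sum_add_distrib, sum_qExp]
  omega

theorem qCover_mul_swap_iff {w : Perm (Fin n)} {i j : Fin n} (hw : w i < w j) :
    QCover k (α, w) (α, w * swap i j) ↔ (i : ℕ) ≤ k ∧ (k : ℕ) < j ∧
      ∀ t, i < t → t < j → ¬ (w i < w t ∧ w t < w j) := by
  constructor
  · rintro ⟨i', j', hi', hj', hy | hy, length_eq⟩
    · have invLength_eq : invLength (w * swap i j) = invLength w + 1 := by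
        simp only [qLength] at length_eq
        omega
      have hij : i ≠ j := fun e => hw.ne (congrArg w e)
      obtain ⟨rfl, rfl⟩ | ⟨rfl, rfl⟩ :=
        (swap_eq_swap_iff hij).1 (mul_left_cancel (Prod.ext_iff.1 hy).2)
      · exact ⟨hi', hj', (invLength_mul_swap_eq_add_one_iff (by omega) hw).1 invLength_eq⟩
      · have := invLength_mul_swap_of_gt (w := w) (i := j) (j := i) (by omega) hw
        rw [swap_comm] at this
        omega
    · have := congrFun (Prod.ext_iff.1 hy).1 k
      simp [qExp_apply_eq_one hi' hj'] at this
  · rintro ⟨hi, hj, h⟩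
    refine ⟨i, j, hi, hj, Or.inl rfl, ?_⟩
    have := (invLength_mul_swap_eq_add_one_iff (by omega) hw).2 h
    simp only [qLength]
    omega

theorem qCover_add_qExp_mul_swap_iff {w : Perm (Fin n)} {i j : Fin n} (hij : i < j)
    (hw : w j < w i) :
    QCover k (α, w) (α + qExp i j, w * swap i j) ↔ (i : ℕ) ≤ k ∧ (k : ℕ) < j ∧
      ∀ t, i < t → t < j → w j < w t ∧ w t < w i := by
  constructor
  · rintro ⟨i', j', hi', hj', hy | hy, length_eq⟩
    · have := congrFun (Prod.ext_iff.1 hy).1 ⟨i, by omega⟩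
      simp [qExp_apply_eq_one (i := i) (j := j) (t := ⟨i, by omega⟩) le_rfl hij] at this
    · obtain ⟨rfl, rfl⟩ | ⟨rfl, rfl⟩ :=
        (swap_eq_swap_iff hij.ne).1 (mul_left_cancel (Prod.ext_iff.1 hy).2)
      · exact ⟨hi', hj', (invLength_mul_swap_add_eq_add_one_iff hij hw).1
          ((qLength_add_qExp _ _ _ _).1 length_eq)⟩
      · omega
  · rintro ⟨hi, hj, h⟩
    exact ⟨i, j, hi, hj, Or.inr rfl, (qLength_add_qExp _ _ _ _).2
      ((invLength_mul_swap_add_eq_add_one_iff hij hw).2 h)⟩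

/-- The condition for `v_{ab}` to act as non-zero on a permutation in which the letter `e` stands at
position `p e`. The cyclic order of the letters makes it uniform in the classical case `a < b` and
the quantum case `b < a`. -/
def Moves (k : Fin (n - 1)) (p : Perm (Fin n)) (a b : Fin n) : Prop :=
  (p a : ℕ) ≤ k ∧ (k : ℕ) < p b ∧ ∀ e, p a < p e → p e < p b → ¬ sbtw a e b

/-- The exponent of the monomial that `v_{ab}` contributes when the letter `e` stands at position
`p e`. -/
def wrapExp (p : Perm (Fin n)) (a b : Fin n) : Fin (n - 1) → ℕ :=
  if a < b then 0 else qExp (p a) (p b)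

theorem qCover_swap_mul_iff {u : Perm (Fin n)} {a b : Fin n} (h : a < b) :
    QCover k (α, u) (α, swap a b * u) ↔ Moves k u.symm a b := by
  rw [swap_mul_eq_mul_swap]
  change QCover k (α, u) (α, u * swap (u.symm a) (u.symm b)) ↔ _
  rw [qCover_mul_swap_iff (by simpa using h)]
  refine and_congr_right fun _ => and_congr_right fun _ => u.forall_congr fun t => ?_
  simp only [symm_apply_apply, apply_symm_apply, Fin.sbtw_iff]
  grind

theorem qCover_add_qExp_swap_mul_iff {u : Perm (Fin n)} {a b : Fin n} (h : b < a) :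
    u.symm a < u.symm b ∧ QCover k (α, u) (α + qExp (u.symm a) (u.symm b), swap a b * u) ↔
      Moves k u.symm a b := by
  rw [swap_mul_eq_mul_swap]
  change _ ∧ QCover k (α, u) (_, u * swap (u.symm a) (u.symm b)) ↔ _
  by_cases hij : u.symm a < u.symm b
  · rw [and_iff_right hij, qCover_add_qExp_mul_swap_iff hij (by simpa using h)]
    refine and_congr_right fun _ => and_congr_right fun _ => u.forall_congr fun t => ?_
    have ne_a : u.symm a < t → u t ≠ a := fun lt e => lt.ne (by rw [← e, symm_apply_apply])
    have ne_b : t < u.symm b → u t ≠ b := fun lt e => lt.ne (by rw [← e, symm_apply_apply])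
    simp only [symm_apply_apply, apply_symm_apply, Fin.sbtw_iff]
    grind
  · exact ⟨fun H => absurd H.1 hij, fun H => absurd (H.1.trans_lt H.2.1) hij⟩

theorem opAct_eq_some_iff {o : Op n} {x y : SnQ n} :
    opAct k o x = some y ↔ Moves k x.2.symm o.1.1 o.1.2 ∧
      (x.1 + wrapExp x.2.symm o.1.1 o.1.2, swap o.1.1 o.1.2 * x.2) = y := by
  obtain ⟨⟨a, b⟩, hab⟩ := o
  obtain ⟨α, u⟩ := x
  simp only [opAct, wrapExp]
  rcases lt_or_gt_of_ne hab with h | h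
  · simp only [h, h.not_gt, qCover_swap_mul_iff, true_and, false_and, if_true, if_false, add_zero,
      Option.ite_none_right_eq_some, Option.some_inj]
  · simp only [h, h.not_gt, qCover_add_qExp_swap_mul_iff h, true_and, false_and, if_false,
      Option.ite_none_right_eq_some, Option.some_inj]

end Covers

section Runs

variable {n : ℕ} {k : Fin (n - 1)} {p : Perm (Fin n)}

/-- A list of operators, the one acting first standing first, acts as non-zero on a permutation in
which the letter `e` stands at position `p e`. -/
def Run (k : Fin (n - 1)) : Perm (Fin n) → List (Op n) → Prop
  | _, [] => True
  | p, o :: l => Moves k p o.1.1 o.1.2 ∧ Run k (p * swap o.1.1 o.1.2) l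

/-- The exponent of the monomial that a list of operators contributes, when the letter `e` initially
stands at position `p e`. -/
def runExp : Perm (Fin n) → List (Op n) → Fin (n - 1) → ℕ
  | _, [] => 0
  | p, o :: l => wrapExp p o.1.1 o.1.2 + runExp (p * swap o.1.1 o.1.2) l

/-- The permutation of the letters that a list of operators brings about. -/
def runPerm : List (Op n) → Perm (Fin n)
  | [] => 1
  | o :: l => runPerm l * swap o.1.1 o.1.2

/-- Two lists of operators act as non-zero on the permutation in which the letter `e` stands at
position `p e`, and with the same result. -/
structure Coterminal (k : Fin (n - 1)) (p : Perm (Fin n)) (l l' : List (Op n)) : Prop where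
  run_left : Run k p l
  run_right : Run k p l'
  runExp_eq : runExp p l = runExp p l'
  runPerm_eq : runPerm l = runPerm l'

namespace Coterminal

variable {o : Op n} {l l' l'' : List (Op n)}

theorem refl (h : Run k p l) : Coterminal k p l l := ⟨h, h, rfl, rfl⟩

theorem symm (h : Coterminal k p l l') : Coterminal k p l' l :=
  ⟨h.run_right, h.run_left, h.runExp_eq.symm, h.runPerm_eq.symm⟩

theorem trans (h : Coterminal k p l l') (h' : Coterminal k p l' l'') : Coterminal k p l l'' :=
  ⟨h.run_left, h'.run_right, h.runExp_eq.trans h'.runExp_eq, h.runPerm_eq.trans h'.runPerm_eq⟩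

theorem cons (ho : Moves k p o.1.1 o.1.2) (h : Coterminal k (p * swap o.1.1 o.1.2) l l') :
    Coterminal k p (o :: l) (o :: l') :=
  ⟨⟨ho, h.run_left⟩, ⟨ho, h.run_right⟩, congrArg (wrapExp p o.1.1 o.1.2 + ·) h.runExp_eq,
    congrArg (· * swap o.1.1 o.1.2) h.runPerm_eq⟩

theorem of_cons (h : Coterminal k p (o :: l) (o :: l')) :
    Coterminal k (p * swap o.1.1 o.1.2) l l' :=
  ⟨h.run_left.2, h.run_right.2, add_left_cancel h.runExp_eq, mul_right_cancel h.runPerm_eq⟩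

end Coterminal

/-- Two lists of operators act in the same way on all permutations, for all `k`. -/
def SameAction (l l' : List (Op n)) : Prop :=
  ∀ k p, Run k p l ∨ Run k p l' → Coterminal k p l l'

/-- The operators of a composition, in the order in which they act. -/
def ops (w : Word n) : List (Op n) := (FreeMonoid.toList w).reverse

theorem ops_injective : Function.Injective (ops (n := n)) := fun _ _ h =>
  FreeMonoid.toList.injective (List.reverse_injective h)

theorem length_ops (w : Word n) : (ops w).length = w.length := by
  simp [ops, FreeMonoid.length]

theorem ops_eq_cons_iff {w : Word n} {o : Op n} {l : List (Op n)} :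
    ops w = o :: l ↔ ∃ w', w = w' * FreeMonoid.of o ∧ ops w' = l := by
  refine ⟨fun h => ⟨FreeMonoid.ofList l.reverse, ops_injective ?_, by simp [ops]⟩, ?_⟩
  · rw [h]
    simp [ops]
  · rintro ⟨w', rfl, rfl⟩
    simp [ops]

theorem wordAct_mul (k : Fin (n - 1)) (w w' : Word n) (x : Option (SnQ n)) :
    wordAct k (w * w') x = wordAct k w (wordAct k w' x) := by
  rw [map_mul]
  rfl

theorem wordAct_none (k : Fin (n - 1)) (w : Word n) : wordAct k w none = none := by
  induction w using FreeMonoid.recOn with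
  | one => rfl
  | of_mul o w ih =>
    rw [wordAct_mul, ih]
    rfl

theorem wordAct_eq_some_iff {w : Word n} {x y : SnQ n} :
    wordAct k w (some x) = some y ↔
      Run k x.2.symm (ops w) ∧ (x.1 + runExp x.2.symm (ops w), runPerm (ops w) * x.2) = y := by
  generalize hl : ops w = l
  induction l generalizing w x with
  | nil =>
    obtain rfl : w = 1 := ops_injective hl
    simp only [map_one, Run, runExp, runPerm, true_and, add_zero, one_mul]
    exact Option.some_inj
  | cons o l ih =>
    obtain ⟨w, rfl, hw⟩ := ops_eq_cons_iff.1 hl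
    rw [wordAct_mul]
    change wordAct k w (opAct k o x) = some y ↔ _
    rcases hz : opAct k o x with _ | z
    · rw [wordAct_none]
      refine iff_of_false (by simp) fun H => ?_
      rw [opAct_eq_some_iff.2 ⟨H.1.1, rfl⟩] at hz
      simp at hz
    · obtain ⟨moves, rfl⟩ := opAct_eq_some_iff.1 hz
      rw [ih hw]
      simp only [Run, moves, true_and, runExp, runPerm, ← add_assoc, mul_assoc]
      rfl

theorem not_equivalent_zero_iff {w : Word n} :
    ¬ Equivalent (w : WithZero (Word n)) 0 ↔ ∃ k p, Run k p (ops w) := by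
  simp only [Equivalent, not_forall]
  refine exists_congr fun k => ⟨fun ⟨u, h⟩ => ?_, fun ⟨p, hp⟩ => ⟨(0, p.symm), ?_⟩⟩
  · obtain ⟨y, hy⟩ := Option.ne_none_iff_exists'.1 h
    exact ⟨_, (wordAct_eq_some_iff.1 hy).1⟩
  · change wordAct k w (some (0, p.symm)) ≠ none
    rw [wordAct_eq_some_iff.2 ⟨hp, rfl⟩]
    exact Option.some_ne_none _

theorem equivalent_iff {w w' : Word n} :
    Equivalent (w : WithZero (Word n)) w' ↔ SameAction (ops w) (ops w') := by
  constructor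
  · intro H k p
    have coterminal_of_run {w₁ w₂ : Word n}
        (h : wordAct k w₁ (some (0, p.symm)) = wordAct k w₂ (some (0, p.symm)))
        (h₁ : Run k p (ops w₁)) : Coterminal k p (ops w₁) (ops w₂) := by
      rw [wordAct_eq_some_iff.2 ⟨h₁, rfl⟩, eq_comm, wordAct_eq_some_iff, Prod.ext_iff] at h
      simp only [zero_add, symm_symm, mul_left_inj] at h
      exact ⟨h₁, h.1, h.2.1.symm, h.2.2.symm⟩
    rintro (h | h)
    · exact coterminal_of_run (H k _) h
    · exact (coterminal_of_run (H k _).symm h).symm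
  · intro H k x
    change wordAct k w (some x) = wordAct k w' (some x)
    have some_of_some {w₁ w₂ : Word n} (h : SameAction (ops w₁) (ops w₂)) (y : SnQ n)
        (hy : wordAct k w₁ (some x) = some y) : wordAct k w₂ (some x) = some y := by
      rw [wordAct_eq_some_iff] at hy ⊢
      have h' := h k _ (.inl hy.1)
      exact ⟨h'.run_right, by rw [← h'.runExp_eq, ← h'.runPerm_eq, hy.2]⟩
    ext y
    exact ⟨some_of_some H y, some_of_some (fun k p h => (H k p h.symm).symm) y⟩

end Runs

section Commutation

variable {n : ℕ} {k : Fin (n - 1)} {p : Perm (Fin n)}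

/-- Two operators have no letter in common. -/
def IsDisjoint (o o' : Op n) : Prop :=
  o.1.1 ≠ o'.1.1 ∧ o.1.1 ≠ o'.1.2 ∧ o.1.2 ≠ o'.1.1 ∧ o.1.2 ≠ o'.1.2

instance (o o' : Op n) : Decidable (IsDisjoint o o') := inferInstanceAs (Decidable (_ ∧ _))

instance (a b c : Fin n) : Decidable (sbtw a b c) := inferInstanceAs (Decidable (_ ∨ _))

/-- The restriction that a non-zero action of `v_{ab}` puts on an operator acting immediately after
it: the letter `a` has just left the first `k` positions and `b` has just entered them, and the
letters standing between the two avoid the cyclic interval from `a` to `b`. -/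
def CanFollow (o o' : Op n) : Prop :=
  o'.1.1 ≠ o.1.1 ∧ o'.1.2 ≠ o.1.2 ∧
    (o'.1.1 = o.1.2 → o'.1.2 ≠ o.1.1 → ¬ sbtw o.1.1 o'.1.2 o.1.2) ∧
    (o'.1.2 = o.1.1 → o'.1.1 ≠ o.1.2 → ¬ sbtw o.1.1 o'.1.1 o.1.2) ∧
    (o'.1.1 ≠ o.1.2 → o'.1.2 ≠ o.1.1 → (sbtw o.1.1 o'.1.1 o.1.2 ↔ sbtw o.1.1 o'.1.2 o.1.2))

instance (o o' : Op n) : Decidable (CanFollow o o') := inferInstanceAs (Decidable (_ ∧ _))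

theorem IsDisjoint.symm {o o' : Op n} (h : IsDisjoint o o') : IsDisjoint o' o :=
  ⟨h.1.symm, h.2.2.1.symm, h.2.1.symm, h.2.2.2.symm⟩

theorem IsDisjoint.swap_mul_swap {o o' : Op n} (h : IsDisjoint o o') :
    swap o.1.1 o.1.2 * swap o'.1.1 o'.1.2 = swap o'.1.1 o'.1.2 * swap o.1.1 o.1.2 := by
  rw [swap_mul_eq_mul_swap, swap_inv, swap_apply_of_ne_of_ne h.1 h.2.1,
    swap_apply_of_ne_of_ne h.2.2.1 h.2.2.2]

theorem IsDisjoint.wrapExp_mul_swap {o o' : Op n} (h : IsDisjoint o o') (p : Perm (Fin n)) :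
    wrapExp (p * swap o.1.1 o.1.2) o'.1.1 o'.1.2 = wrapExp p o'.1.1 o'.1.2 := by
  rw [wrapExp, Perm.mul_apply, Perm.mul_apply, swap_apply_of_ne_of_ne h.1.symm h.2.2.1.symm,
    swap_apply_of_ne_of_ne h.2.1.symm h.2.2.2.symm, wrapExp]

theorem moves_mul_swap_iff {q : Perm (Fin n)} {a b : Fin n} :
    Moves k (p * q) a b ↔ (p (q a) : ℕ) ≤ k ∧ (k : ℕ) < p (q b) ∧
      ∀ e, p (q a) < p e → p e < p (q b) → ¬ sbtw a (q.symm e) b :=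
  and_congr_right fun _ => and_congr_right fun _ => q.forall_congr fun e => by simp

theorem Moves.canFollow {o o' : Op n} (h : Moves k p o.1.1 o.1.2)
    (h' : Moves k (p * swap o.1.1 o.1.2) o'.1.1 o'.1.2) : CanFollow o o' := by
  obtain ⟨⟨a, b⟩, hab⟩ := o
  obtain ⟨⟨c, d⟩, hcd⟩ := o'
  obtain ⟨ha, hb, h⟩ := h
  obtain ⟨hc, hd, h'⟩ := moves_mul_swap_iff.1 h'
  have inj (x y) : p x = p y → x = y := fun e => p.injective e
  have h_c := h c
  have h_d := h d
  have h'_a := h' a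
  have h'_b := h' b
  have := inj a c
  have := inj a d
  have := inj b c
  have := inj b d
  simp only [CanFollow, symm_swap, swap_apply_left, swap_apply_right, Fin.sbtw_iff] at *
  simp only [swap_apply_def] at *
  refine ⟨?_, ?_, ?_, ?_, ?_⟩ <;> grind

theorem Moves.comm {o o' : Op n} (hd : IsDisjoint o o') (h : Moves k p o.1.1 o.1.2)
    (h' : Moves k (p * swap o.1.1 o.1.2) o'.1.1 o'.1.2) :
    Moves k p o'.1.1 o'.1.2 ∧ Moves k (p * swap o'.1.1 o'.1.2) o.1.1 o.1.2 := by
  have same_side := (h.canFollow h').2.2.2.2 hd.2.2.1.symm hd.2.1.symm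
  obtain ⟨⟨a, b⟩, hab⟩ := o
  obtain ⟨⟨c, d⟩, hcd⟩ := o'
  obtain ⟨ac, ad, bc, bd⟩ := hd
  rw [moves_mul_swap_iff] at *
  obtain ⟨ha, hb, h⟩ := h
  obtain ⟨hc, hd, h'⟩ := h'
  have inj (x y) : p x = p y → x = y := fun e => p.injective e
  simp only [swap_apply_of_ne_of_ne, symm_swap, *, ne_eq, Ne.symm, not_false_iff] at *
  have h'_a := h' a
  have h'_b := h' b
  have h_c := h c
  have h_d := h d
  simp only [swap_apply_left, swap_apply_right] at h'_a h'_b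
  refine ⟨⟨hc, hd, fun e he he' => ?_⟩, by grind, by grind, fun e he he' => ?_⟩
  · have := h' e
    rw [swap_apply_def] at this
    simp only [Fin.sbtw_iff] at *
    grind
  · have := h e
    rw [swap_apply_def]
    simp only [Fin.sbtw_iff] at *
    grind

/-- Two lists of operators differ by interchanging neighbouring operators without common letters. -/
inductive Rearranged : List (Op n) → List (Op n) → Prop
  | refl (l : List (Op n)) : Rearranged l l
  | swap {o o' : Op n} (h : IsDisjoint o o') (l : List (Op n)) :
      Rearranged (o :: o' :: l) (o' :: o :: l)
  | cons (o : Op n) {l l' : List (Op n)} (h : Rearranged l l') : Rearranged (o :: l) (o :: l')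
  | trans {l l' l'' : List (Op n)} (h : Rearranged l l') (h' : Rearranged l' l'') :
      Rearranged l l''

namespace Rearranged

variable {l l' : List (Op n)}

theorem symm (h : Rearranged l l') : Rearranged l' l := by
  induction h with
  | refl l => exact .refl l
  | swap hd l => exact .swap hd.symm l
  | cons o _ ih => exact .cons o ih
  | trans _ _ ih ih' => exact ih'.trans ih

theorem coterminal (h : Rearranged l l') (hr : Run k p l) : Coterminal k p l l' := by
  induction h generalizing p with
  | refl l => exact .refl hr
  | @swap o o' hd l =>
    obtain ⟨moves_o, moves_o', run_l⟩ := hr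
    have comm := moves_o.comm hd moves_o'
    refine ⟨⟨moves_o, moves_o', run_l⟩, ⟨comm.1, comm.2, ?_⟩, ?_, ?_⟩
    · rwa [mul_assoc, ← hd.swap_mul_swap, ← mul_assoc]
    · simp only [runExp]
      rw [hd.wrapExp_mul_swap, hd.symm.wrapExp_mul_swap, mul_assoc, mul_assoc, hd.swap_mul_swap,
        add_left_comm]
    · simp only [runPerm, mul_assoc, hd.swap_mul_swap]
  | cons o _ ih => exact .cons hr.1 (ih hr.2)
  | trans _ _ ih ih' => exact (ih hr).trans (ih' (ih hr).run_right)

theorem sameAction (h : Rearranged l l') : SameAction l l' := fun _ _ hr =>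
  hr.elim h.coterminal fun hr => (h.symm.coterminal hr).symm

end Rearranged

theorem IsDisjoint.lowerCon_mul_comm {o o' : Op n} (h : IsDisjoint o o') :
    lowerCon n 3 ((FreeMonoid.of o' * FreeMonoid.of o : Word n) : WithZero (Word n))
      (FreeMonoid.of o * FreeMonoid.of o' : Word n) := by
  refine ConGen.Rel.of _ _ ⟨equivalent_iff.2 ?_, ?_⟩
  · exact (Rearranged.swap h []).sameAction
  · change max (FreeMonoid.length (FreeMonoid.of o' * FreeMonoid.of o))
      (FreeMonoid.length (FreeMonoid.of o * FreeMonoid.of o')) < 3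
    simp

theorem lowerCon_of_rearranged_ops {w w' : Word n} (h : Rearranged (ops w) (ops w')) :
    lowerCon n 3 (w : WithZero (Word n)) w' := by
  generalize hl : ops w = l at h
  generalize hl' : ops w' = l' at h
  induction h generalizing w w' with
  | refl l =>
    rw [ops_injective (hl.trans hl'.symm)]
    exact (lowerCon n 3).refl _
  | @swap o o' hd l =>
    obtain ⟨w₁, rfl, h₁⟩ := ops_eq_cons_iff.1 hl
    obtain ⟨w₂, rfl, rfl⟩ := ops_eq_cons_iff.1 h₁
    obtain ⟨w₁', rfl, h₁'⟩ := ops_eq_cons_iff.1 hl'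
    obtain ⟨w₂', rfl, h₂'⟩ := ops_eq_cons_iff.1 h₁'
    obtain rfl := ops_injective h₂'
    simpa only [mul_assoc, WithZero.coe_mul] using
      (lowerCon n 3).mul ((lowerCon n 3).refl (w₂' : WithZero (Word n))) hd.lowerCon_mul_comm
  | cons o _ ih =>
    obtain ⟨w₁, rfl, h₁⟩ := ops_eq_cons_iff.1 hl
    obtain ⟨w₂, rfl, h₂⟩ := ops_eq_cons_iff.1 hl'
    simpa only [WithZero.coe_mul] using (lowerCon n 3).mul (ih h₁ h₂) ((lowerCon n 3).refl _)
  | @trans l₁ l₂ l₃ _ _ ih ih' =>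
    obtain ⟨w₂, h₂⟩ : ∃ w₂ : Word n, ops w₂ = l₂ := ⟨FreeMonoid.ofList l₂.reverse, by simp [ops]⟩
    exact (lowerCon n 3).trans (ih hl h₂) (ih' h₂ hl')

end Commutation

section Motion

variable {n : ℕ} {k : Fin (n - 1)} {p : Perm (Fin n)}

/-- The letters occurring in a list of operators. -/
def letters : List (Op n) → Finset (Fin n)
  | [] => ∅
  | o :: l => insert o.1.1 (insert o.1.2 (letters l))

/-- Along `v_{ab}` the letter at the position of `a` moves up cyclically to `b`, and the letter at
the position of `b` moves down cyclically to `a`. This is the signed number of times that the letter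
at the position of `c` passes from `n` to `1`. -/
def turn (o : Op n) (c : Fin n) : ℤ :=
  if o.1.2 < o.1.1 then if c = o.1.1 then 1 else if c = o.1.2 then -1 else 0 else 0

/-- The signed number of times that, along a list of operators, the letter at the position of `c`
passes from `n` to `1`. -/
def turns : List (Op n) → Fin n → ℤ
  | [], _ => 0
  | o :: l, c => turn o c + turns l (swap o.1.1 o.1.2 c)

/-- The motion of the letter at the position of `c` along a list of operators: its number of turns
around the cycle and its final value. The order is that of the universal cover of the cycle. -/
def motion (l : List (Op n)) (c : Fin n) : ℤ ×ₗ Fin n := toLex (turns l c, runPerm l c)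

/-- The increments of an exponent vector, extended by zero at both ends. -/
def increment (α : Fin (n - 1) → ℕ) (q : Fin n) : ℤ :=
  (if h : (q : ℕ) < n - 1 then (α ⟨q, h⟩ : ℤ) else 0) -
    if h : 0 < (q : ℕ) then (α ⟨q - 1, by omega⟩ : ℤ) else 0

theorem increment_zero (q : Fin n) : increment 0 q = 0 := by
  simp [increment]

theorem increment_add (α β : Fin (n - 1) → ℕ) (q : Fin n) :
    increment (α + β) q = increment α q + increment β q := by
  simp only [increment, Pi.add_apply]
  split_ifs <;> push_cast <;> ring

theorem increment_injective : Function.Injective (increment (n := n)) := by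
  intro α β h
  have eq_at (t : ℕ) (ht : t < n - 1) : α ⟨t, ht⟩ = β ⟨t, ht⟩ := by
    induction t with
    | zero =>
      have := congrFun h ⟨0, by omega⟩
      simpa [increment, ht] using this
    | succ t ih =>
      have := congrFun h ⟨t + 1, by omega⟩
      simpa [increment, ht, ih (by omega)] using this
  exact funext fun t => eq_at t t.2

theorem increment_qExp {i j : Fin n} (hij : i < j) (q : Fin n) :
    increment (qExp i j) q = if q = i then 1 else if q = j then -1 else 0 := by
  simp only [increment, qExp]
  split_ifs <;> grind

theorem increment_wrapExp {o : Op n} (h : p o.1.1 < p o.1.2) (c : Fin n) :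
    increment (wrapExp p o.1.1 o.1.2) (p c) = turn o c := by
  simp only [wrapExp, turn]
  rcases lt_or_gt_of_ne o.2 with hab | hab
  · rw [if_pos hab, if_neg hab.not_gt, increment_zero]
  · rw [if_neg hab.not_gt, if_pos hab, increment_qExp h]
    simp only [p.injective.eq_iff]

theorem increment_runExp {l : List (Op n)} (h : Run k p l) (c : Fin n) :
    increment (runExp p l) (p c) = turns l c := by
  induction l generalizing p c with
  | nil => exact increment_zero _
  | cons o l ih =>
    have := ih h.2 (swap o.1.1 o.1.2 c)
    rw [Perm.mul_apply, swap_apply_self] at this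
    rw [runExp, increment_add, this, increment_wrapExp (h.1.1.trans_lt h.1.2.1), turns]

theorem coterminal_iff_motion_eq {l l' : List (Op n)} (h : Run k p l) (h' : Run k p l') :
    Coterminal k p l l' ↔ motion l = motion l' := by
  refine ⟨fun H => funext fun c => ?_, fun H => ⟨h, h', ?_, ?_⟩⟩
  · rw [motion, motion, ← increment_runExp h, ← increment_runExp h', H.runExp_eq, H.runPerm_eq]
  · refine increment_injective (funext fun q => ?_)
    have := congrArg (fun m => (ofLex m).1) (congrFun H (p.symm q))
    simpa only [motion, ofLex_toLex, ← increment_runExp h, ← increment_runExp h',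
      apply_symm_apply] using this
  · exact Equiv.ext fun c => congrArg (fun m => (ofLex m).2) (congrFun H c)

theorem motion_of_notMem_letters {l : List (Op n)} {c : Fin n} (h : c ∉ letters l) :
    motion l c = toLex (0, c) := by
  induction l with
  | nil => rfl
  | cons o l ih =>
    simp only [letters, Finset.mem_insert, not_or] at h
    have := ih h.2.2
    simp only [motion, toLex_inj, Prod.mk.injEq] at this ⊢
    simp [turns, turn, runPerm, swap_apply_of_ne_of_ne, h, this]

theorem motion_left {l : List (Op n)} {c : Fin n} (h : Run k p l) (hc : (p c : ℕ) ≤ k) :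
    toLex (0, c) ≤ motion l c ∧ (c ∈ letters l → toLex (0, c) < motion l c) := by
  induction l generalizing p c with
  | nil => exact ⟨le_rfl, fun hc => absurd hc (Finset.notMem_empty _)⟩
  | cons o l ih =>
    obtain ⟨⟨⟨a, b⟩, hab⟩, rfl⟩ : ∃ o' : Op n, o' = o := ⟨_, rfl⟩
    have hb : c ≠ b := by
      rintro rfl
      exact hc.not_gt h.1.2.1
    have := ih (c := swap a b c) h.2 (by simpa using hc)
    simp only [motion, Prod.Lex.toLex_le_toLex, Prod.Lex.toLex_lt_toLex, turns, turn, runPerm,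
      Perm.mul_apply, letters, Finset.mem_insert] at this ⊢
    by_cases ha : c = a
    · subst ha
      simp only [swap_apply_left] at this ⊢
      grind
    · rw [swap_apply_of_ne_of_ne ha hb] at this ⊢
      grind

theorem motion_right {l : List (Op n)} {c : Fin n} (h : Run k p l) (hc : (k : ℕ) < p c) :
    motion l c ≤ toLex (0, c) ∧ (c ∈ letters l → motion l c < toLex (0, c)) := by
  induction l generalizing p c with
  | nil => exact ⟨le_rfl, fun hc => absurd hc (Finset.notMem_empty _)⟩
  | cons o l ih =>
    obtain ⟨⟨⟨a, b⟩, hab⟩, rfl⟩ : ∃ o' : Op n, o' = o := ⟨_, rfl⟩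
    have ha : c ≠ a := by
      rintro rfl
      exact hc.not_ge h.1.1
    have := ih (c := swap a b c) h.2 (by simpa using hc)
    simp only [motion, Prod.Lex.toLex_le_toLex, Prod.Lex.toLex_lt_toLex, turns, turn, runPerm,
      Perm.mul_apply, letters, Finset.mem_insert] at this ⊢
    by_cases hb : c = b
    · subst hb
      simp only [swap_apply_right] at this ⊢
      grind
    · rw [swap_apply_of_ne_of_ne ha hb] at this ⊢
      grind

theorem mem_letters_iff_motion_ne {l : List (Op n)} (h : Run k p l) {c : Fin n} :
    c ∈ letters l ↔ motion l c ≠ toLex (0, c) := by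
  refine ⟨fun hc => ?_, fun hc => by_contra fun hcl => hc (motion_of_notMem_letters hcl)⟩
  rcases le_or_gt (p c : ℕ) k with hk | hk
  · exact ((motion_left h hk).2 hc).ne'
  · exact ((motion_right h hk).2 hc).ne

theorem Coterminal.letters_eq {l l' : List (Op n)} (h : Coterminal k p l l') :
    letters l = letters l' := by
  ext c
  rw [mem_letters_iff_motion_ne h.run_left, mem_letters_iff_motion_ne h.run_right,
    (coterminal_iff_motion_eq h.run_left h.run_right).1 h]

/-- The letters of an operator move at most as far along it as they do along a list. -/
def Fits (o : Op n) (l : List (Op n)) : Prop :=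
  motion [o] o.1.1 ≤ motion l o.1.1 ∧ motion l o.1.2 ≤ motion [o] o.1.2

theorem fits_cons {o : Op n} {l : List (Op n)} (h : Run k p (o :: l)) : Fits o (o :: l) := by
  have left := (motion_left (c := o.1.2) h.2 (by simpa using h.1.1)).1
  have right := (motion_right (c := o.1.1) h.2 (by simpa using h.1.2.1)).1
  simp only [Fits, motion, Prod.Lex.toLex_le_toLex, turns, runPerm, Perm.mul_apply, one_mul,
    swap_apply_left, swap_apply_right] at left right ⊢
  grind

end Motion

section Classification

variable {n : ℕ} {k : Fin (n - 1)} {p : Perm (Fin n)}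

/-- The restrictions that a non-zero action puts on three operators acting one after the other. -/
def Admissible (o₁ o₂ o₃ : Op n) : Prop :=
  CanFollow o₁ o₂ ∧ CanFollow o₂ o₃ ∧ (IsDisjoint o₁ o₂ ∨ IsDisjoint o₂ o₃ → CanFollow o₁ o₃) ∧
    (o₁ = o₃ → o₁.1.1 = o₂.1.2 ∧ o₁.1.2 = o₂.1.1)

instance (o₁ o₂ o₃ : Op n) : Decidable (Admissible o₁ o₂ o₃) := inferInstanceAs (Decidable (_ ∧ _))

theorem Run.admissible {o₁ o₂ o₃ : Op n} (h : Run k p [o₁, o₂, o₃]) : Admissible o₁ o₂ o₃ := by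
  obtain ⟨h₁, h₂, h₃, -⟩ := h
  have h₁₂ := h₁.canFollow h₂
  refine ⟨h₁₂, h₂.canFollow h₃, ?_, ?_⟩
  · rintro (hd | hd)
    · rw [mul_assoc, hd.swap_mul_swap, ← mul_assoc] at h₃
      exact (h₁.comm hd h₂).2.canFollow h₃
    · exact h₁.canFollow (h₂.comm hd h₃).1
  · rintro rfl
    have left := h₃.1
    have right := h₃.2.1
    have := h₁.1
    have := h₁.2.1
    rw [Perm.mul_apply, Perm.mul_apply] at left right
    constructor <;> by_contra hne
    · rw [swap_apply_of_ne_of_ne h₁₂.1.symm hne, swap_apply_left] at left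
      omega
    · rw [swap_apply_of_ne_of_ne hne h₁₂.2.1.symm, swap_apply_right] at right
      omega

/-- Relations (i), (ii), (iii), (vii), (viii), (ix) and (x), on lists of operators; the letters `a`,
`b`, `c`, `d` stand in cyclic order, where `d = c` is allowed. -/
def OuterPair (l l' : List (Op n)) : Prop :=
  ∃ a b c d : Fin n, sbtw a b c ∧ (d = c ∨ sbtw c d a) ∧
    l.map Subtype.val = [(a, b), (b, c), (d, b)] ∧ l'.map Subtype.val = [(a, c), (d, a), (a, b)]

/-- The other relations, on lists of operators; the letters `a`, `b`, `c`, `d` stand in cyclic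
order, where `a = b` is allowed. -/
def InnerPair (l l' : List (Op n)) : Prop :=
  ∃ a b c d : Fin n, sbtw b c d ∧ (a = b ∨ sbtw d a b) ∧
    l.map Subtype.val = [(c, d), (b, c), (c, a)] ∧ l'.map Subtype.val = [(b, d), (d, a), (c, d)]

instance (l l' : List (Op n)) : Decidable (OuterPair l l') := inferInstanceAs (Decidable (∃ _, _))

instance (l l' : List (Op n)) : Decidable (InnerPair l l') := inferInstanceAs (Decidable (∃ _, _))

/-- The listed relations, on lists of operators. -/
def CyclicPair (l l' : List (Op n)) : Prop := OuterPair l l' ∨ InnerPair l l'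

instance (l l' : List (Op n)) : Decidable (CyclicPair l l') := inferInstanceAs (Decidable (_ ∨ _))

instance (o : Op n) (l : List (Op n)) : Decidable (Fits o l) := inferInstanceAs (Decidable (_ ∧ _))

instance (P : Op n → Prop) [DecidablePred P] : Decidable (∀ o, P o) :=
  decidable_of_iff (∀ a b, ∀ h : a ≠ b, P ⟨(a, b), h⟩) ⟨fun H o => H _ _ o.2, fun H _ _ _ => H _⟩

/-- The effect of `Rearranged` on three operators, as a decidable condition. -/
def IsInterchange (o₁ o₂ o₃ : Op n) (l : List (Op n)) : Prop :=
  l = [o₁, o₂, o₃] ∨ IsDisjoint o₁ o₂ ∧ l = [o₂, o₁, o₃] ∨ IsDisjoint o₂ o₃ ∧ l = [o₁, o₃, o₂] ∨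
    IsDisjoint o₁ o₃ ∧ (IsDisjoint o₁ o₂ ∧ l = [o₂, o₃, o₁] ∨ IsDisjoint o₂ o₃ ∧ l = [o₃, o₁, o₂] ∨
      IsDisjoint o₁ o₂ ∧ IsDisjoint o₂ o₃ ∧ l = [o₃, o₂, o₁])

instance (o₁ o₂ o₃ : Op n) (l : List (Op n)) : Decidable (IsInterchange o₁ o₂ o₃ l) :=
  inferInstanceAs (Decidable (_ ∨ _))

/-- The classification of the pairs of operators that involve `m` letters and have a given
motion. -/
def PairClassification (m : ℕ) : Prop :=
  ∀ o₁ o₂ : Op m, CanFollow o₁ o₂ → (∀ c, c ∈ letters [o₁, o₂]) → ∀ o₁' o₂', CanFollow o₁' o₂' →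
    motion [o₁, o₂] = motion [o₁', o₂'] →
      [o₁', o₂'] = [o₁, o₂] ∨ IsDisjoint o₁ o₂ ∧ [o₁', o₂'] = [o₂, o₁]

/-- The classification of the triples of operators that involve `m` letters and have a given
motion. The restrictions stand between the quantifiers to cut its decision by enumeration short. -/
def TripleClassification (m : ℕ) : Prop :=
  ∀ o₁ o₂ : Op m, CanFollow o₁ o₂ → ∀ o₃, Admissible o₁ o₂ o₃ → (∀ c, c ∈ letters [o₁, o₂, o₃]) →
    ∀ o₁', Fits o₁' [o₁, o₂, o₃] → ∀ o₂', CanFollow o₁' o₂' → ∀ o₃', CanFollow o₂' o₃' →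
      motion [o₁, o₂, o₃] = motion [o₁', o₂', o₃'] → Admissible o₁' o₂' o₃' →
        IsInterchange o₁ o₂ o₃ [o₁', o₂', o₃'] ∨
          CyclicPair [o₁, o₂, o₃] [o₁', o₂', o₃'] ∨ CyclicPair [o₁', o₂', o₃'] [o₁, o₂, o₃]

instance (m : ℕ) : Decidable (PairClassification m) := inferInstanceAs (Decidable (∀ _, _))

instance (m : ℕ) : Decidable (TripleClassification m) := inferInstanceAs (Decidable (∀ _, _))

set_option maxRecDepth 100000 in
theorem pairClassification {m : ℕ} (hm : m ≤ 4) : PairClassification m := by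
  interval_cases m <;> decide +kernel

set_option maxRecDepth 100000 in
theorem tripleClassification {m : ℕ} (hm : m ≤ 4) : TripleClassification m := by
  interval_cases m <;> decide +kernel

end Classification

section Relabelling

variable {m n : ℕ} {k : Fin (n - 1)} {p : Perm (Fin n)} (e : Fin m ↪o Fin n)

/-- The operator `v_{e(a) e(b)}`. -/
def mapOp (o : Op m) : Op n := ⟨(e o.1.1, e o.1.2), e.injective.ne o.2⟩

theorem sbtw_map_iff {a b c : Fin m} : sbtw (e a) (e b) (e c) ↔ sbtw a b c := by
  simp only [Fin.sbtw_iff, e.lt_iff_lt]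

theorem isDisjoint_mapOp_iff {o o' : Op m} :
    IsDisjoint (mapOp e o) (mapOp e o') ↔ IsDisjoint o o' := by
  simp only [IsDisjoint, mapOp, e.injective.ne_iff]

theorem canFollow_mapOp_iff {o o' : Op m} :
    CanFollow (mapOp e o) (mapOp e o') ↔ CanFollow o o' := by
  simp only [CanFollow, mapOp, e.injective.ne_iff, e.injective.eq_iff, sbtw_map_iff]

theorem admissible_mapOp_iff {o₁ o₂ o₃ : Op m} :
    Admissible (mapOp e o₁) (mapOp e o₂) (mapOp e o₃) ↔ Admissible o₁ o₂ o₃ := by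
  simp only [Admissible, canFollow_mapOp_iff, isDisjoint_mapOp_iff]
  simp only [mapOp, Subtype.ext_iff, Prod.ext_iff, e.injective.eq_iff]

theorem runPerm_map (l : List (Op m)) (c : Fin m) :
    runPerm (l.map (mapOp e)) (e c) = e (runPerm l c) := by
  induction l generalizing c with
  | nil => rfl
  | cons o l ih =>
    simp only [List.map_cons, runPerm, Perm.mul_apply, ← ih, e.injective.map_swap, mapOp]

theorem turns_map (l : List (Op m)) (c : Fin m) : turns (l.map (mapOp e)) (e c) = turns l c := by
  induction l generalizing c with
  | nil => rfl
  | cons o l ih =>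
    simp only [List.map_cons, turns, turn, ← ih, e.injective.map_swap, mapOp, e.lt_iff_lt,
      e.injective.eq_iff]

theorem motion_map_le_motion_map_iff {l l' : List (Op m)} {c : Fin m} :
    motion (l.map (mapOp e)) (e c) ≤ motion (l'.map (mapOp e)) (e c) ↔
      motion l c ≤ motion l' c := by
  simp only [motion, Prod.Lex.toLex_le_toLex, turns_map, runPerm_map, e.le_iff_le]

theorem fits_mapOp_iff {o : Op m} {l : List (Op m)} :
    Fits (mapOp e o) (l.map (mapOp e)) ↔ Fits o l :=
  and_congr (motion_map_le_motion_map_iff e (l := [o])) (motion_map_le_motion_map_iff e (l' := [o]))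

theorem motion_eq_of_map {l l' : List (Op m)}
    (h : motion (l.map (mapOp e)) = motion (l'.map (mapOp e))) : motion l = motion l' :=
  funext fun c => le_antisymm
    ((motion_map_le_motion_map_iff e).1 (congrFun h (e c)).le)
    ((motion_map_le_motion_map_iff e).1 (congrFun h (e c)).ge)

theorem letters_map (l : List (Op m)) :
    letters (l.map (mapOp e)) = (letters l).map e.toEmbedding := by
  induction l with
  | nil => rfl
  | cons o l ih => simp [letters, ih, Finset.map_insert, mapOp]

theorem exists_map_eq {l : List (Op n)} (h : ↑(letters l) ⊆ Set.range e) :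
    ∃ l₀ : List (Op m), l₀.map (mapOp e) = l := by
  induction l with
  | nil => exact ⟨[], rfl⟩
  | cons o l ih =>
    simp only [letters, Finset.coe_insert, Set.insert_subset_iff] at h
    obtain ⟨⟨a, ha⟩, ⟨b, hb⟩, hl⟩ := h
    obtain ⟨l₀, rfl⟩ := ih hl
    refine ⟨⟨(a, b), fun hab => o.2 (ha.symm.trans ((congrArg e hab).trans hb))⟩ :: l₀, ?_⟩
    simp [mapOp, ha, hb]

theorem exists_relabelling {l l' : List (Op n)} (h : letters l = letters l') :
    ∃ (e : Fin (letters l).card ↪o Fin n) (l₀ l₀' : List (Op (letters l).card)),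
      l₀.map (mapOp e) = l ∧ l₀'.map (mapOp e) = l' ∧ ∀ c, c ∈ letters l₀ := by
  let e := (letters l).orderEmbOfFin rfl
  obtain ⟨l₀, hl₀⟩ := exists_map_eq e ((letters l).range_orderEmbOfFin rfl).ge
  obtain ⟨l₀', hl₀'⟩ := exists_map_eq e (h ▸ ((letters l).range_orderEmbOfFin rfl).ge :
    ↑(letters l') ⊆ Set.range e)
  refine ⟨e, l₀, l₀', hl₀, hl₀', fun c => ?_⟩
  have : e c ∈ letters (l₀.map (mapOp e)) := hl₀.symm ▸ (letters l).orderEmbOfFin_mem rfl c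
  rwa [letters_map, ← RelEmbedding.coe_toEmbedding, Finset.mem_map'] at this

theorem Rearranged.map {l l' : List (Op m)} (h : Rearranged l l') :
    Rearranged (l.map (mapOp e)) (l'.map (mapOp e)) := by
  induction h with
  | refl l => exact .refl _
  | swap hd l => exact .swap ((isDisjoint_mapOp_iff e).2 hd) _
  | cons o _ ih => exact .cons _ ih
  | trans _ _ ih ih' => exact ih.trans ih'

theorem map_val_map_mapOp (l : List (Op m)) :
    (l.map (mapOp e)).map Subtype.val = (l.map Subtype.val).map (Prod.map e e) := by
  rw [List.map_map, List.map_map]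
  rfl

theorem OuterPair.map {l l' : List (Op m)} (h : OuterPair l l') :
    OuterPair (l.map (mapOp e)) (l'.map (mapOp e)) := by
  obtain ⟨a, b, c, d, habc, hd, hl, hl'⟩ := h
  refine ⟨e a, e b, e c, e d, (sbtw_map_iff e).2 habc, ?_, ?_, ?_⟩
  · exact hd.imp (congrArg e) (sbtw_map_iff e).2
  · rw [map_val_map_mapOp, hl]
    rfl
  · rw [map_val_map_mapOp, hl']
    rfl

theorem InnerPair.map {l l' : List (Op m)} (h : InnerPair l l') :
    InnerPair (l.map (mapOp e)) (l'.map (mapOp e)) := by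
  obtain ⟨a, b, c, d, hbcd, ha, hl, hl'⟩ := h
  refine ⟨e a, e b, e c, e d, (sbtw_map_iff e).2 hbcd, ?_, ?_, ?_⟩
  · exact ha.imp (congrArg e) (sbtw_map_iff e).2
  · rw [map_val_map_mapOp, hl]
    rfl
  · rw [map_val_map_mapOp, hl']
    rfl

theorem CyclicPair.map {l l' : List (Op m)} (h : CyclicPair l l') :
    CyclicPair (l.map (mapOp e)) (l'.map (mapOp e)) :=
  h.imp (OuterPair.map e) (InnerPair.map e)

theorem IsInterchange.rearranged {o₁ o₂ o₃ : Op n} {l : List (Op n)}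
    (h : IsInterchange o₁ o₂ o₃ l) : Rearranged [o₁, o₂, o₃] l := by
  rcases h with rfl | ⟨h₁₂, rfl⟩ | ⟨h₂₃, rfl⟩ |
    ⟨h₁₃, ⟨h₁₂, rfl⟩ | ⟨h₂₃, rfl⟩ | ⟨h₁₂, h₂₃, rfl⟩⟩
  · exact .refl _
  · exact .swap h₁₂ _
  · exact .cons _ (.swap h₂₃ _)
  · exact (Rearranged.swap h₁₂ _).trans (.cons _ (.swap h₁₃ _))
  · exact (Rearranged.cons _ (.swap h₂₃ _)).trans (.swap h₁₃ _)
  · exact ((Rearranged.cons _ (.swap h₂₃ _)).trans (.swap h₁₃ _)).trans (.cons _ (.swap h₁₂ _))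

theorem card_letters_cons_le (o : Op n) (l : List (Op n)) :
    (letters (o :: l)).card ≤ (letters l).card + 2 :=
  (Finset.card_insert_le _ _).trans (Nat.succ_le_succ (Finset.card_insert_le _ _))

theorem rearranged_of_coterminal_pair {r s r' s' : Op n} (h : Coterminal k p [r, s] [r', s']) :
    Rearranged [r, s] [r', s'] := by
  obtain ⟨e, l, l', hl, hl', mem⟩ := exists_relabelling h.letters_eq
  have card_le : (letters [r, s]).card ≤ 4 :=
    (card_letters_cons_le _ _).trans (Nat.add_le_add_right (card_letters_cons_le _ _) 2)
  have motion_eq := (coterminal_iff_motion_eq h.run_left h.run_right).1 h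
  have canFollow := h.run_left.1.canFollow h.run_left.2.1
  have canFollow' := h.run_right.1.canFollow h.run_right.2.1
  generalize (letters [r, s]).card = m at *
  match l, l', hl, hl', mem with
  | [o₁, o₂], [o₁', o₂'], rfl, rfl, mem =>
    rw [canFollow_mapOp_iff] at canFollow canFollow'
    refine Rearranged.map e (l := [_, _]) (l' := [_, _]) ?_
    rcases pairClassification card_le o₁ o₂ canFollow mem o₁' o₂' canFollow'
      (motion_eq_of_map e motion_eq) with heq | ⟨hd, heq⟩
    · exact heq ▸ .refl _
    · exact heq ▸ .swap hd _

theorem rearranged_or_cyclicPair_of_card_le {o₁ o₂ o₃ o₁' o₂' o₃' : Op n}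
    (h : Coterminal k p [o₁, o₂, o₃] [o₁', o₂', o₃'])
    (card_le : (letters [o₁, o₂, o₃]).card ≤ 4) :
    Rearranged [o₁, o₂, o₃] [o₁', o₂', o₃'] ∨ CyclicPair [o₁, o₂, o₃] [o₁', o₂', o₃'] ∨
      CyclicPair [o₁', o₂', o₃'] [o₁, o₂, o₃] := by
  obtain ⟨e, l, l', hl, hl', mem⟩ := exists_relabelling h.letters_eq
  have motion_eq := (coterminal_iff_motion_eq h.run_left h.run_right).1 h
  have admissible := h.run_left.admissible
  have admissible' := h.run_right.admissible
  have fits := fits_cons h.run_right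
  rw [Fits, ← motion_eq, ← Fits] at fits
  generalize (letters [o₁, o₂, o₃]).card = m at *
  match l, l', hl, hl', mem with
  | [r₁, r₂, r₃], [r₁', r₂', r₃'], rfl, rfl, mem =>
    rw [admissible_mapOp_iff] at admissible admissible'
    exact (tripleClassification card_le r₁ r₂ admissible.1 r₃ admissible mem r₁'
      ((fits_mapOp_iff e (l := [_, _, _])).1 fits) r₂' admissible'.1 r₃' admissible'.2.1
      (motion_eq_of_map e motion_eq) admissible').imp (fun h => h.rearranged.map e)
      (Or.imp (CyclicPair.map e) (CyclicPair.map e))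

end Relabelling

section ManyLetters

variable {n : ℕ} {k : Fin (n - 1)} {p : Perm (Fin n)} {o o₁ o₂ o₃ r s : Op n}

theorem card_letters_cons_le_of_not_isDisjoint {l : List (Op n)} (hr : r ∈ l)
    (h : ¬ IsDisjoint o r) : (letters (o :: l)).card ≤ (letters l).card + 1 := by
  have subset : r.1.1 ∈ letters l ∧ r.1.2 ∈ letters l := by
    induction l with
    | nil => simp at hr
    | cons o' l ih => grind [letters]
  by_cases h₁ : o.1.1 ∈ letters l
  · rw [letters, Finset.insert_eq_of_mem (Finset.mem_insert_of_mem h₁)]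
    exact Finset.card_insert_le _ _
  · have h₂ : o.1.2 ∈ letters l := by grind [IsDisjoint]
    rw [letters, Finset.insert_eq_of_mem h₂]
    exact Finset.card_insert_le _ _

theorem card_letters_le_four (h : ¬ IsDisjoint o₂ o₃)
    (h' : ¬ IsDisjoint o₁ o₂ ∨ ¬ IsDisjoint o₁ o₃) : (letters [o₁, o₂, o₃]).card ≤ 4 := by
  have card_cons : (letters [o₁, o₂, o₃]).card ≤ (letters [o₂, o₃]).card + 1 :=
    h'.elim (card_letters_cons_le_of_not_isDisjoint (by simp))
      (card_letters_cons_le_of_not_isDisjoint (by simp))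
  have card_pair := card_letters_cons_le_of_not_isDisjoint (l := [o₃]) (by simp) h
  have card_single : (letters [o₃]).card ≤ 2 := card_letters_cons_le o₃ []
  omega

theorem exists_rearranged_isDisjoint (h : 4 < (letters [o₁, o₂, o₃]).card) :
    ∃ o r s, Rearranged [o₁, o₂, o₃] [o, r, s] ∧ IsDisjoint o r ∧ IsDisjoint o s := by
  have letters_comm : letters [o₁, o₂, o₃] = letters [o₂, o₁, o₃] := by grind [letters]
  by_cases h₂₃ : IsDisjoint o₂ o₃
  · by_cases h₁₂ : IsDisjoint o₁ o₂
    · exact ⟨o₂, o₁, o₃, .swap h₁₂ _, h₁₂.symm, h₂₃⟩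
    · have h₁₃ : IsDisjoint o₁ o₃ := by
        by_contra h₁₃
        exact h.not_ge (letters_comm ▸ card_letters_le_four h₁₃ (.inl fun h => h₁₂ h.symm))
      exact ⟨o₃, o₁, o₂, (Rearranged.cons _ (.swap h₂₃ _)).trans (.swap h₁₃ _), h₁₃.symm, h₂₃.symm⟩
  · have := mt (card_letters_le_four (o₁ := o₁) h₂₃) h.not_ge
    push Not at this
    exact ⟨o₁, o₂, o₃, .refl _, this⟩

theorem mem_letters_singleton {c : Fin n} : c ∈ letters [o] ↔ c = o.1.1 ∨ c = o.1.2 := by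
  simp [letters]

theorem not_isDisjoint_iff : ¬ IsDisjoint o r ↔ ∃ c ∈ letters [o], c ∈ letters [r] := by
  simp only [IsDisjoint, mem_letters_singleton, or_and_right, exists_or, exists_eq_left]
  tauto

theorem motion_cons_of_notMem {l : List (Op n)} {c : Fin n} (h : c ∉ letters [o]) :
    motion (o :: l) c = motion l c := by
  rw [mem_letters_singleton, not_or] at h
  simp only [motion, turns, turn, runPerm, Perm.mul_apply, swap_apply_of_ne_of_ne h.1 h.2, h.1,
    h.2, if_false, ite_self, zero_add]

theorem motion_of_isDisjoint (hr : IsDisjoint o r) (hs : IsDisjoint o s) {c : Fin n}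
    (hc : c ∈ letters [o]) : motion [o, r, s] c = motion [o] c := by
  rw [mem_letters_singleton] at hc
  simp only [motion, turns, turn, runPerm, Perm.mul_apply]
  grind [IsDisjoint]

theorem eq_of_motion_eq {c : Fin n} (ho : c ∈ letters [o]) (hr : c ∈ letters [r])
    (h : motion [o] c = motion [r] c) : o = r := by
  obtain ⟨⟨a, b⟩, hab⟩ := o
  obtain ⟨⟨d, e⟩, hde⟩ := r
  simp only [motion, turns, turn, runPerm, one_mul, toLex_inj, Prod.mk.injEq, swap_apply_def,
    mem_letters_singleton, Subtype.mk.injEq] at *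
  grind

theorem isDisjoint_and_eq_of_motion_eq (mem : letters [o] ⊆ letters [r, s])
    (motion_eq : ∀ c ∈ letters [o], motion [r, s] c = motion [o] c) :
    IsDisjoint r s ∧ (o = r ∨ o = s) := by
  have left := motion_eq _ (mem_letters_singleton.2 (.inl rfl))
  have right := motion_eq _ (mem_letters_singleton.2 (.inr rfl))
  replace mem := mem (mem_letters_singleton.2 (.inl rfl))
  obtain ⟨⟨a, b⟩, hab⟩ := o
  obtain ⟨⟨c, d⟩, hcd⟩ := r
  obtain ⟨⟨e, f⟩, hef⟩ := s
  simp only [motion, turns, turn, runPerm, Perm.mul_apply, letters, IsDisjoint, Subtype.mk.injEq,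
    toLex_inj, Prod.mk.injEq, Finset.mem_insert, Finset.notMem_empty, Perm.one_apply,
    swap_apply_left, swap_apply_right, add_zero, or_false, if_true] at *
  obtain ⟨turns_left, perm_left⟩ := left
  obtain ⟨-, perm_right⟩ := right
  have disjoint : c ≠ e ∧ c ≠ f ∧ d ≠ e ∧ d ≠ f := by
    simp only [swap_apply_def] at perm_left perm_right
    grind
  refine ⟨disjoint, ?_⟩
  obtain ⟨rfl, rfl⟩ | ⟨rfl, rfl⟩ | ⟨rfl, rfl⟩ | ⟨rfl, rfl⟩ :
      a = c ∧ b = d ∨ a = e ∧ b = f ∨ b = c ∧ a = d ∨ b = e ∧ a = f := by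
    simp only [swap_apply_def] at perm_left perm_right
    grind
  · simp
  · simp
  · simp only [swap_apply_right] at turns_left
    grind
  · simp only [swap_apply_of_ne_of_ne disjoint.2.1.symm disjoint.2.2.2.symm] at turns_left
    grind

theorem rearranged_of_motion_eq (hr : IsDisjoint o r) (hs : IsDisjoint o s)
    (mem : letters [o₁] ⊆ letters [o, r, s])
    (motion_eq : ∀ c ∈ letters [o₁], motion [o, r, s] c = motion [o₁] c) :
    ∃ r' s', Rearranged [o, r, s] [o₁, r', s'] := by
  by_cases hd : IsDisjoint o o₁
  · have notMem {c : Fin n} (hc : c ∈ letters [o₁]) : c ∉ letters [o] := fun hc' =>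
      not_isDisjoint_iff.2 ⟨c, hc', hc⟩ hd
    obtain ⟨hrs, rfl | rfl⟩ := isDisjoint_and_eq_of_motion_eq (o := o₁) (r := r) (s := s)
      (fun c hc => by grind [letters, notMem hc, mem hc])
      (fun c hc => by rw [← motion_eq c hc, motion_cons_of_notMem (notMem hc)])
    · exact ⟨_, _, .swap hr _⟩
    · exact ⟨_, _, (Rearranged.cons _ (.swap hrs _)).trans (.swap hs _)⟩
  · obtain ⟨c, hc, hc'⟩ := not_isDisjoint_iff.1 hd
    rw [← eq_of_motion_eq hc hc' ((motion_of_isDisjoint hr hs hc).symm.trans (motion_eq c hc'))]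
    exact ⟨r, s, .refl _⟩

theorem rearranged_of_lt_card {o₁' o₂' o₃' : Op n}
    (h : Coterminal k p [o₁, o₂, o₃] [o₁', o₂', o₃'])
    (hc : 4 < (letters [o₁, o₂, o₃]).card) : Rearranged [o₁, o₂, o₃] [o₁', o₂', o₃'] := by
  obtain ⟨o, r, s, rearranged, hr, hs⟩ := exists_rearranged_isDisjoint hc
  obtain ⟨o', r', s', rearranged', hr', hs'⟩ := exists_rearranged_isDisjoint (h.letters_eq ▸ hc)
  have coterminal : Coterminal k p [o, r, s] [o', r', s'] :=
    ((rearranged.coterminal h.run_left).symm.trans h).trans (rearranged'.coterminal h.run_right)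
  have motion_eq := (coterminal_iff_motion_eq coterminal.run_left coterminal.run_right).1 coterminal
  obtain ⟨r'', s'', rearranged''⟩ : ∃ r'' s'', Rearranged [o, r, s] [o', r'', s''] := by
    refine rearranged_of_motion_eq hr hs (fun c hc => ?_) fun c hc => ?_
    · rw [coterminal.letters_eq]
      simpa [letters] using Or.imp_right Or.inl (mem_letters_singleton.1 hc)
    · rw [motion_eq, motion_of_isDisjoint hr' hs' hc]
  have tails := ((rearranged''.coterminal coterminal.run_left).symm.trans coterminal).of_cons
  exact (rearranged.trans rearranged'').trans
    ((Rearranged.cons _ (rearranged_of_coterminal_pair tails)).trans rearranged'.symm)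

theorem rearranged_or_cyclicPair {l l' : List (Op n)} (h : Coterminal k p l l')
    (hl : l.length = 3) (hl' : l'.length = 3) :
    Rearranged l l' ∨ CyclicPair l l' ∨ CyclicPair l' l := by
  obtain ⟨o₁, o₂, o₃, rfl⟩ := List.length_eq_three.1 hl
  obtain ⟨o₁', o₂', o₃', rfl⟩ := List.length_eq_three.1 hl'
  rcases le_or_gt (letters [o₁, o₂, o₃]).card 4 with hc | hc
  · exact rearranged_or_cyclicPair_of_card_le h hc
  · exact .inl (rearranged_of_lt_card h hc)

end ManyLetters

section CyclicPairs

variable {n : ℕ} {k : Fin (n - 1)} {p : Perm (Fin n)} {a b c d : Fin n}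

theorem moves_outer_left_second_iff (h : sbtw a b c) :
    Moves k (p * swap a b) b c ↔
      (p a : ℕ) ≤ k ∧ (k : ℕ) < p c ∧ ∀ e, p a < p e → p e < p c → ¬ sbtw b e c := by
  rw [Fin.sbtw_iff] at h
  rw [moves_mul_swap_iff, swap_apply_right, swap_apply_of_ne_of_ne (x := c) (by omega) (by omega)]
  refine and_congr_right fun _ => and_congr_right fun _ => forall_congr' fun e => ?_
  refine forall₂_congr fun he _ => ?_
  have : e ≠ a := by
    rintro rfl
    exact he.false
  simp only [symm_swap, swap_apply_def, Fin.sbtw_iff]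
  grind

theorem moves_outer_left_third_iff (h : sbtw a b c) (hd : d = c ∨ sbtw c d a) :
    Moves k (p * swap a b * swap b c) d b ↔
      (p (swap a c d) : ℕ) ≤ k ∧ (k : ℕ) < p c ∧
        ∀ e, p (swap a c d) < p e → p e < p c → e ≠ a → e ≠ b ∧ ¬ sbtw d e b := by
  simp only [Fin.sbtw_iff] at h hd
  have apply_b : (swap a b * swap b c) b = c := by
    rw [Perm.mul_apply, swap_apply_left, swap_apply_of_ne_of_ne (by omega) (by omega)]
  have apply_d : (swap a b * swap b c) d = swap a c d := by
    simp only [Perm.mul_apply, swap_apply_def]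
    grind
  have symm_apply (e) : (swap a b * swap b c).symm e = swap b c (swap a b e) := rfl
  rw [mul_assoc, moves_mul_swap_iff, apply_b, apply_d]
  refine and_congr_right fun _ => and_congr_right fun _ => forall_congr' fun e => ?_
  refine forall₂_congr fun _ he => ?_
  have : e ≠ c := by
    rintro rfl
    exact he.false
  simp only [symm_apply, swap_apply_def, Fin.sbtw_iff]
  grind

theorem moves_outer_right_second_iff (h : sbtw a b c) (hd : d = c ∨ sbtw c d a) :
    Moves k (p * swap a c) d a ↔
      (p (swap a c d) : ℕ) ≤ k ∧ (k : ℕ) < p c ∧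
        ∀ e, p (swap a c d) < p e → p e < p c → ¬ sbtw d e a := by
  simp only [Fin.sbtw_iff] at h hd
  rw [moves_mul_swap_iff, swap_apply_left]
  refine and_congr_right fun _ => and_congr_right fun _ => forall_congr' fun e => ?_
  refine forall₂_congr fun _ he => ?_
  have : e ≠ c := by
    rintro rfl
    exact he.false
  simp only [symm_swap, swap_apply_def, Fin.sbtw_iff]
  grind

theorem moves_outer_right_third_iff (h : sbtw a b c) (hd : d = c ∨ sbtw c d a) :
    Moves k (p * swap a c * swap d a) a b ↔
      (p (swap a c d) : ℕ) ≤ k ∧ (k : ℕ) < p b ∧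
        ∀ e, p (swap a c d) < p e → p e < p b → ¬ sbtw a e b := by
  simp only [Fin.sbtw_iff] at h hd
  have apply_b : (swap a c * swap d a) b = b := by
    simp only [Perm.mul_apply, swap_apply_def]
    grind
  have symm_apply (e) : (swap a c * swap d a).symm e = swap d a (swap a c e) := rfl
  rw [mul_assoc, moves_mul_swap_iff, apply_b, Perm.mul_apply, swap_apply_right]
  refine and_congr_right fun _ => and_congr_right fun _ => forall_congr' fun e => ?_
  refine forall₂_congr fun he _ => ?_
  have : e ≠ swap a c d := by
    rintro rfl
    exact he.false
  simp only [symm_apply, swap_apply_def, Fin.sbtw_iff] at *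
  grind

theorem moves_outer_iff (h : sbtw a b c) (hd : d = c ∨ sbtw c d a) :
    (Moves k p a b ∧ Moves k (p * swap a b) b c ∧ Moves k (p * swap a b * swap b c) d b) ↔
      (Moves k p a c ∧ Moves k (p * swap a c) d a ∧ Moves k (p * swap a c * swap d a) a b) := by
  rw [moves_outer_left_second_iff h, moves_outer_left_third_iff h hd,
    moves_outer_right_second_iff h hd, moves_outer_right_third_iff h hd]
  have : d = c ∧ swap a c d = a ∨ d ≠ c ∧ swap a c d = d := by
    simp only [Fin.sbtw_iff, swap_apply_def] at *
    grind
  have eq_iff (x y : Fin n) : p x = p y ↔ x = y := p.injective.eq_iff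
  unfold Moves
  constructor
  · rintro ⟨⟨ha, hb, hab⟩, ⟨-, hc, hbc⟩, hs, -, hdb⟩
    have c_lt_b : p c < p b := by
      have := hdb b
      have := eq_iff b c
      have := eq_iff a b
      simp only [Fin.sbtw_iff] at h
      grind
    refine ⟨⟨ha, hc, fun e => ?_⟩, ⟨hs, hc, fun e => ?_⟩, hs, hb, fun e => ?_⟩
    all_goals
      have := hab e
      have := hbc e
      have := hdb e
      have := eq_iff e
      simp only [Fin.sbtw_iff] at *
      clear hab hbc hdb eq_iff
      grind
  · rintro ⟨⟨ha, hc, hac⟩, ⟨-, -, hda⟩, hs, hb, hab⟩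
    have := hac b
    refine ⟨⟨ha, hb, fun e => ?_⟩, ⟨ha, hc, fun e => ?_⟩, hs, hc, fun e => ?_⟩
    all_goals
      have := hac e
      have := hda e
      have := hab e
      have := eq_iff e
      simp only [Fin.sbtw_iff] at *
      clear hac hda hab eq_iff
      grind

theorem OuterPair.exists_eq {l l' : List (Op n)} (h : OuterPair l l') :
    ∃ (a b c d : Fin n) (ab : a ≠ b) (bc : b ≠ c) (db : d ≠ b) (ac : a ≠ c) (da : d ≠ a),
      sbtw a b c ∧ (d = c ∨ sbtw c d a) ∧ l = [⟨(a, b), ab⟩, ⟨(b, c), bc⟩, ⟨(d, b), db⟩] ∧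
        l' = [⟨(a, c), ac⟩, ⟨(d, a), da⟩, ⟨(a, b), ab⟩] := by
  obtain ⟨a, b, c, d, habc, hd, hl, hl'⟩ := h
  have ne := habc
  have ne' := hd
  simp only [Fin.sbtw_iff] at ne ne'
  refine ⟨a, b, c, d, by omega, by omega, by omega, by omega, by omega, habc, hd, ?_, ?_⟩
  · exact List.map_injective_iff.2 Subtype.val_injective hl
  · exact List.map_injective_iff.2 Subtype.val_injective hl'

theorem InnerPair.exists_eq {l l' : List (Op n)} (h : InnerPair l l') :
    ∃ (a b c d : Fin n) (cd : c ≠ d) (bc : b ≠ c) (ca : c ≠ a) (bd : b ≠ d) (da : d ≠ a),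
      sbtw b c d ∧ (a = b ∨ sbtw d a b) ∧ l = [⟨(c, d), cd⟩, ⟨(b, c), bc⟩, ⟨(c, a), ca⟩] ∧
        l' = [⟨(b, d), bd⟩, ⟨(d, a), da⟩, ⟨(c, d), cd⟩] := by
  obtain ⟨a, b, c, d, hbcd, ha, hl, hl'⟩ := h
  have ne := hbcd
  have ne' := ha
  simp only [Fin.sbtw_iff] at ne ne'
  refine ⟨a, b, c, d, by omega, by omega, by omega, by omega, by omega, hbcd, ha, ?_, ?_⟩
  · exact List.map_injective_iff.2 Subtype.val_injective hl
  · exact List.map_injective_iff.2 Subtype.val_injective hl'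

theorem OuterPair.run_iff {l l' : List (Op n)} (h : OuterPair l l') : Run k p l ↔ Run k p l' := by
  obtain ⟨a, b, c, d, ab, bc, db, ac, da, habc, hd, rfl, rfl⟩ := h.exists_eq
  simpa only [Run, and_true] using moves_outer_iff habc hd

theorem OuterPair.motion_eq {l l' : List (Op n)} (h : OuterPair l l') : motion l = motion l' := by
  obtain ⟨a, b, c, d, ab, bc, db, ac, da, habc, hd, rfl, rfl⟩ := h.exists_eq
  funext e
  simp only [motion, turns, turn, runPerm, toLex_inj, Prod.mk.injEq, one_mul, Perm.mul_apply,
    swap_apply_def]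
  simp only [Fin.sbtw_iff] at habc hd
  by_cases e = a <;> by_cases e = b <;> by_cases e = c <;> by_cases e = d <;> grind

end CyclicPairs

section Duality

variable {n : ℕ} {k : Fin (n - 1)} {p : Perm (Fin n)}

/-- The image of an operator under the duality that reverses the order of the letters and that of
the positions. -/
def dualOp (o : Op n) : Op n :=
  ⟨(o.1.2.rev, o.1.1.rev), fun h => o.2 (Fin.rev_injective h).symm⟩

/-- The image of an arrangement of the letters under the duality of `dualOp`. -/
def dualPerm (p : Perm (Fin n)) : Perm (Fin n) := Fin.revPerm * p * Fin.revPerm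

theorem dualPerm_apply_rev (c : Fin n) : dualPerm p c.rev = (p c).rev := by
  simp [dualPerm]

theorem dualPerm_dualPerm : dualPerm (dualPerm p) = p := by
  ext c
  simp [dualPerm]

theorem dualPerm_mul (p q : Perm (Fin n)) : dualPerm (p * q) = dualPerm p * dualPerm q := by
  ext c
  simp [dualPerm]

theorem dualPerm_swap (a b : Fin n) : dualPerm (swap a b) = swap b.rev a.rev := by
  ext c
  obtain ⟨c, rfl⟩ := Fin.rev_surjective c
  rw [dualPerm_apply_rev, swap_comm, Fin.rev_injective.map_swap]

theorem moves_dual_iff {a b : Fin n} :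
    Moves k.rev (dualPerm p) b.rev a.rev ↔ Moves k p a b := by
  simp only [Moves, dualPerm_apply_rev, Fin.val_rev]
  rw [and_left_comm]
  refine and_congr (by omega) (and_congr (by omega) (Fin.revPerm.forall_congr fun e => ?_))
  obtain ⟨e, rfl⟩ := Fin.rev_surjective e
  simp only [Fin.revPerm_apply, dualPerm_apply_rev, Fin.rev_rev]
  simp only [Fin.sbtw_iff]
  grind

theorem run_dual_iff {l : List (Op n)} :
    Run k.rev (dualPerm p) (l.map dualOp) ↔ Run k p l := by
  induction l generalizing p with
  | nil => rfl
  | cons o l ih =>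
    refine and_congr moves_dual_iff ?_
    rw [← ih, dualPerm_mul, dualPerm_swap]
    rfl

theorem turns_dual (l : List (Op n)) (c : Fin n) : turns (l.map dualOp) c.rev = -turns l c := by
  induction l generalizing c with
  | nil => rfl
  | cons o l ih =>
    have turns_tail := ih (swap o.1.1 o.1.2 c)
    have := o.2
    simp only [List.map_cons, turns, turn, dualOp, Fin.rev_lt_rev, Fin.rev_inj]
    rw [← dualPerm_swap, dualPerm_apply_rev, turns_tail]
    grind

theorem runPerm_dual (l : List (Op n)) : runPerm (l.map dualOp) = dualPerm (runPerm l) := by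
  induction l with
  | nil => simp [runPerm, dualPerm, Equiv.ext_iff]
  | cons o l ih =>
    rw [List.map_cons, runPerm, runPerm, dualPerm_mul, dualPerm_swap, ih]
    rfl

theorem motion_dual_eq_iff {l l' : List (Op n)} :
    motion (l.map dualOp) = motion (l'.map dualOp) ↔ motion l = motion l' := by
  rw [funext_iff, funext_iff, Fin.rev_surjective.forall]
  simp only [motion, toLex_inj, Prod.mk.injEq, turns_dual, runPerm_dual, dualPerm_apply_rev,
    neg_inj, Fin.rev_inj]

theorem InnerPair.dual {l l' : List (Op n)} (h : InnerPair l l') :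
    OuterPair (l.map dualOp) (l'.map dualOp) := by
  obtain ⟨a, b, c, d, hbcd, hd, hl, hl'⟩ := h
  refine ⟨d.rev, c.rev, b.rev, a.rev, ?_, ?_, ?_, ?_⟩
  · simp only [Fin.sbtw_iff, Fin.rev_lt_rev] at hbcd ⊢
    omega
  · simp only [Fin.sbtw_iff, Fin.rev_lt_rev, Fin.rev_inj] at hd ⊢
    omega
  · have := congrArg (List.map fun o => (o.2.rev, o.1.rev)) hl
    simpa [dualOp, Function.comp_def] using this
  · have := congrArg (List.map fun o => (o.2.rev, o.1.rev)) hl'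
    simpa [dualOp, Function.comp_def] using this

theorem CyclicPair.sameAction {l l' : List (Op n)} (h : CyclicPair l l') : SameAction l l' := by
  obtain ⟨run_iff, motion_eq⟩ :
      (∀ k p, Run k p l ↔ Run k p l') ∧ motion l = motion l' := by
    rcases h with h | h
    · exact ⟨fun _ _ => h.run_iff, h.motion_eq⟩
    · refine ⟨fun k p => ?_, motion_dual_eq_iff.1 h.dual.motion_eq⟩
      rw [← run_dual_iff, h.dual.run_iff, run_dual_iff]
  intro k p hp
  rw [← run_iff, or_self] at hp
  exact (coterminal_iff_motion_eq hp ((run_iff k p).1 hp)).2 motion_eq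

theorem exists_perm_apply_getElem_eq {l : List (Fin n)} (h : l.Nodup) :
    ∃ p : Perm (Fin n), ∀ (i : ℕ) (hi : i < l.length), (p l[i] : ℕ) = i := by
  have length_le : l.length ≤ n := by simpa using h.length_le_card
  obtain ⟨p, hp⟩ := Perm.exists_smul_eq_embedding ⟨l.get, List.nodup_iff_injective_get.1 h⟩
    (Fin.castLEEmb length_le)
  exact ⟨p, fun i hi => congrArg Fin.val (DFunLike.congr_fun hp ⟨i, hi⟩)⟩

theorem exists_perm_outer {a b c d : Fin n} (h : sbtw a b c) (hd : d = c ∨ sbtw c d a) :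
    ∃ (k : Fin (n - 1)) (p : Perm (Fin n)), (p a : ℕ) = k ∧ (p c : ℕ) = k + 1 ∧
      (p b : ℕ) = k + 2 ∧ (p (swap a c d) : ℕ) ≤ k ∧ (k : ℕ) ≤ p (swap a c d) + 1 := by
  simp only [Fin.sbtw_iff] at h hd
  rcases hd with rfl | hd
  · have nodup : [a, d, b].Nodup := by
      simp only [List.nodup_cons, List.mem_cons, List.not_mem_nil, List.nodup_nil, or_false,
        not_false_eq_true, and_true]
      omega
    obtain ⟨p, hp⟩ := exists_perm_apply_getElem_eq nodup
    have pa := hp 0 (by simp)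
    have pd := hp 1 (by simp)
    have pb := hp 2 (by simp)
    simp only [List.getElem_cons_zero, List.getElem_cons_succ] at pa pd pb
    refine ⟨⟨0, by omega⟩, p, pa, pd, pb, ?_⟩
    simp [pa]
  · have nodup : [d, a, c, b].Nodup := by
      simp only [List.nodup_cons, List.mem_cons, List.not_mem_nil, List.nodup_nil, or_false,
        not_false_eq_true, and_true]
      omega
    obtain ⟨p, hp⟩ := exists_perm_apply_getElem_eq nodup
    have pd := hp 0 (by simp)
    have pa := hp 1 (by simp)
    have pc := hp 2 (by simp)
    have pb := hp 3 (by simp)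
    simp only [List.getElem_cons_zero, List.getElem_cons_succ] at pd pa pc pb
    refine ⟨⟨1, by omega⟩, p, pa, pc, pb, ?_⟩
    rw [swap_apply_of_ne_of_ne (by omega) (by omega), pd]
    simp

theorem OuterPair.exists_run {l l' : List (Op n)} (h : OuterPair l l') : ∃ k p, Run k p l := by
  obtain ⟨a, b, c, d, ab, bc, db, ac, da, habc, hd, rfl, rfl⟩ := h.exists_eq
  obtain ⟨k, p, pa, pc, pb, hs, hs'⟩ := exists_perm_outer habc hd
  refine ⟨k, p, ?_, (moves_outer_left_second_iff habc).2 ?_,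
    (moves_outer_left_third_iff habc hd).2 ?_, trivial⟩
  · change Moves k p a b
    refine ⟨pa.le, by omega, fun e he he' => ?_⟩
    obtain rfl : e = c := p.injective (Fin.ext (by omega))
    simp only [Fin.sbtw_iff] at habc ⊢
    omega
  · exact ⟨pa.le, by omega, fun e he he' => by omega⟩
  · exact ⟨hs, by omega, fun e he he' hea => absurd (p.injective (Fin.ext (by omega))) hea⟩

theorem CyclicPair.exists_run {l l' : List (Op n)} (h : CyclicPair l l') : ∃ k p, Run k p l := by
  rcases h with h | h
  · exact h.exists_run
  · obtain ⟨k, p, hp⟩ := h.dual.exists_run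
    refine ⟨k.rev, dualPerm p, run_dual_iff.1 ?_⟩
    rwa [dualPerm_dualPerm, Fin.rev_rev]

end Duality

section Listing

variable {n : ℕ} {x y : Word n}

theorem Listed.cyclicPair (h : Listed x y) : CyclicPair (ops x) (ops y) := by
  cases h with
  | rel_i | rel_ii | rel_iii =>
    exact .inl ⟨_, _, _, _, Fin.sbtw_iff.2 (by omega), .inl rfl, rfl, rfl⟩
  | rel_vii | rel_viii | rel_ix | rel_x =>
    exact .inl ⟨_, _, _, _, Fin.sbtw_iff.2 (by omega), .inr (Fin.sbtw_iff.2 (by omega)), rfl, rfl⟩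
  | rel_iv | rel_v | rel_vi =>
    exact .inr ⟨_, _, _, _, Fin.sbtw_iff.2 (by omega), .inl rfl, rfl, rfl⟩
  | rel_xi | rel_xii | rel_xiii | rel_xiv =>
    exact .inr ⟨_, _, _, _, Fin.sbtw_iff.2 (by omega), .inr (Fin.sbtw_iff.2 (by omega)), rfl, rfl⟩

theorem listed_of_outerPair (h : OuterPair (ops x) (ops y)) : Listed x y := by
  obtain ⟨a, b, c, d, ab, bc, db, ac, da, habc, hd, hx, hy⟩ := h.exists_eq
  obtain rfl : x = v d b db * v b c bc * v a b ab := ops_injective hx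
  obtain rfl : y = v a b ab * v d a da * v a c ac := ops_injective hy
  rw [Fin.sbtw_iff] at habc
  rcases hd with rfl | hd
  · rcases habc with ⟨h₁, h₂⟩ | ⟨h₁, h₂⟩ | ⟨h₁, h₂⟩
    · exact .rel_i h₁ h₂ (h₁.trans h₂)
    · exact .rel_iii h₁ h₂ (h₁.trans h₂)
    · exact .rel_ii h₁ h₂ (h₁.trans h₂)
  · rw [Fin.sbtw_iff] at hd
    have orders : (a < b ∧ b < c ∧ c < d) ∨ (b < c ∧ c < d ∧ d < a) ∨ (c < d ∧ d < a ∧ a < b) ∨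
        (d < a ∧ a < b ∧ b < c) := by omega
    rcases orders with ⟨h₁, h₂, h₃⟩ | ⟨h₁, h₂, h₃⟩ | ⟨h₁, h₂, h₃⟩ | ⟨h₁, h₂, h₃⟩
    · exact .rel_vii h₁ h₂ (h₁.trans h₂) (h₁.trans (h₂.trans h₃)) (h₂.trans h₃) h₃
    · exact .rel_x h₁ h₂ (h₁.trans h₂) (h₁.trans (h₂.trans h₃)) (h₂.trans h₃) h₃
    · exact .rel_ix h₁ h₂ (h₁.trans h₂) (h₁.trans (h₂.trans h₃)) (h₂.trans h₃) h₃
    · exact .rel_viii h₁ h₂ (h₁.trans h₂) (h₁.trans (h₂.trans h₃)) (h₂.trans h₃) h₃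

theorem listed_of_innerPair (h : InnerPair (ops x) (ops y)) : Listed x y := by
  obtain ⟨a, b, c, d, cd, bc, ca, bd, da, hbcd, ha, hx, hy⟩ := h.exists_eq
  obtain rfl : x = v c a ca * v b c bc * v c d cd := ops_injective hx
  obtain rfl : y = v c d cd * v d a da * v b d bd := ops_injective hy
  rw [Fin.sbtw_iff] at hbcd
  rcases ha with rfl | ha
  · rcases hbcd with ⟨h₁, h₂⟩ | ⟨h₁, h₂⟩ | ⟨h₁, h₂⟩
    · exact .rel_iv h₁ h₂ (h₁.trans h₂)
    · exact .rel_vi h₁ h₂ (h₁.trans h₂)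
    · exact .rel_v h₁ h₂ (h₁.trans h₂)
  · rw [Fin.sbtw_iff] at ha
    have orders : (a < b ∧ b < c ∧ c < d) ∨ (b < c ∧ c < d ∧ d < a) ∨ (c < d ∧ d < a ∧ a < b) ∨
        (d < a ∧ a < b ∧ b < c) := by omega
    rcases orders with ⟨h₁, h₂, h₃⟩ | ⟨h₁, h₂, h₃⟩ | ⟨h₁, h₂, h₃⟩ | ⟨h₁, h₂, h₃⟩
    · exact .rel_xi h₁ h₂ (h₁.trans h₂) (h₁.trans (h₂.trans h₃)) (h₂.trans h₃) h₃
    · exact .rel_xiv h₁ h₂ (h₁.trans h₂) (h₁.trans (h₂.trans h₃)) (h₂.trans h₃) h₃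
    · exact .rel_xiii h₁ h₂ (h₁.trans h₂) (h₁.trans (h₂.trans h₃)) (h₂.trans h₃) h₃
    · exact .rel_xii h₁ h₂ (h₁.trans h₂) (h₁.trans (h₂.trans h₃)) (h₂.trans h₃) h₃

theorem listed_iff_cyclicPair : Listed x y ↔ CyclicPair (ops x) (ops y) :=
  ⟨Listed.cyclicPair, fun h => h.elim listed_of_outerPair listed_of_innerPair⟩

end Listing

section Minimality

variable {n : ℕ} {k : Fin (n - 1)} {l l' : List (Op n)}

theorem qLength_of_opAct {o : Op n} {x y : SnQ n} (h : opAct k o x = some y) :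
    qLength y = qLength x + 1 := by
  simp only [opAct] at h
  split_ifs at h with classical quantum
  · obtain ⟨-, i, j, -, -, -, hl⟩ := classical
    rw [← Option.some_inj.1 h, hl]
  · obtain ⟨-, -, i, j, -, -, -, hl⟩ := quantum
    rw [← Option.some_inj.1 h, hl]

theorem qLength_of_wordAct {w : Word n} {x y : SnQ n} (h : wordAct k w (some x) = some y) :
    qLength y = qLength x + w.length := by
  induction w using FreeMonoid.recOn generalizing y with
  | one =>
    rw [map_one] at h
    obtain rfl : x = y := Option.some_inj.1 h
    rw [FreeMonoid.length_one, add_zero]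
  | of_mul o w ih =>
    rw [wordAct_mul] at h
    change (wordAct k w (some x)).bind (opAct k o) = some y at h
    obtain ⟨z, hz, hy⟩ := Option.bind_eq_some_iff.1 h
    rw [qLength_of_opAct hy, ih hz, FreeMonoid.length_mul, FreeMonoid.length_of]
    ring

theorem act_mul (k : Fin (n - 1)) (s t : WithZero (Word n)) (x : Option (SnQ n)) :
    act k (s * t) x = act k s (act k t x) := by
  rcases s with _ | s
  · rfl
  rcases t with _ | t
  · exact (wordAct_none k s).symm
  · exact wordAct_mul k s t x

theorem act_none (k : Fin (n - 1)) (s : WithZero (Word n)) : act k s none = none := by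
  rcases s with _ | s
  · rfl
  · exact wordAct_none k s

namespace Equivalent

variable {p q r : WithZero (Word n)}

theorem symm (h : Equivalent p q) : Equivalent q p := fun k u => (h k u).symm

theorem trans (h : Equivalent p q) (h' : Equivalent q r) : Equivalent p r :=
  fun k u => (h k u).trans (h' k u)

theorem mul_mul (h : Equivalent p q) (s t : WithZero (Word n)) :
    Equivalent (s * p * t) (s * q * t) := by
  intro k u
  simp only [act_mul]
  rcases act k t (some u) with _ | z
  · rw [act_none, act_none k q]
  · rw [h k z]

theorem length_eq {w w' : Word n} (h : Equivalent (w : WithZero (Word n)) w')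
    (h0 : ¬ Equivalent (w : WithZero (Word n)) 0) : w.length = w'.length := by
  simp only [Equivalent, not_forall] at h0
  obtain ⟨k, u, hu⟩ := h0
  obtain ⟨y, hy⟩ := Option.ne_none_iff_exists'.1 hu
  have length_w := qLength_of_wordAct (w := w) hy
  have length_w' := qLength_of_wordAct (w := w') ((h k u).symm.trans hy)
  omega

end Equivalent

theorem IsMinimalEquiv.symm {p q : WithZero (Word n)} (h : IsMinimalEquiv p q) :
    IsMinimalEquiv q p :=
  ⟨h.1.symm, fun hc => h.2 ((lowerCon n _).symm (by rwa [equivDegree, max_comm] at hc))⟩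

theorem Rearranged.eq_of_isChain (h : Rearranged l l')
    (hl : l.IsChain fun o o' => ¬ IsDisjoint o o') : l' = l := by
  induction h with
  | refl l => rfl
  | swap hd l => exact absurd hd (List.isChain_cons_cons.1 hl).1
  | cons o _ ih => rw [ih hl.of_cons]
  | trans _ _ ih ih' =>
    obtain rfl := ih hl
    exact ih' hl

namespace CyclicPair

theorem length_eq (h : CyclicPair l l') : l.length = 3 ∧ l'.length = 3 := by
  rcases h with h | h
  · obtain ⟨_, _, _, _, _, _, _, _, _, _, _, rfl, rfl⟩ := h.exists_eq
    exact ⟨rfl, rfl⟩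
  · obtain ⟨_, _, _, _, _, _, _, _, _, _, _, rfl, rfl⟩ := h.exists_eq
    exact ⟨rfl, rfl⟩

theorem head?_ne (h : CyclicPair l l') : l.head? ≠ l'.head? := by
  rcases h with h | h
  · obtain ⟨a, b, c, d, -, bc, -, -, -, -, -, rfl, rfl⟩ := h.exists_eq
    simp [bc]
  · obtain ⟨a, b, c, d, -, bc, -, -, -, -, -, rfl, rfl⟩ := h.exists_eq
    simp [bc.symm]

theorem getLast?_ne (h : CyclicPair l l') : l.getLast? ≠ l'.getLast? := by
  rcases h with h | h
  · obtain ⟨a, b, c, d, -, -, -, -, da, -, -, rfl, rfl⟩ := h.exists_eq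
    simp [da]
  · obtain ⟨a, b, c, d, -, -, -, -, da, -, -, rfl, rfl⟩ := h.exists_eq
    simp [da.symm]

theorem isChain (h : CyclicPair l l') : l.IsChain fun o o' => ¬ IsDisjoint o o' := by
  rcases h with h | h
  · obtain ⟨a, b, c, d, -, -, -, -, -, -, -, rfl, rfl⟩ := h.exists_eq
    simp [IsDisjoint]
  · obtain ⟨a, b, c, d, -, -, -, -, -, -, -, rfl, rfl⟩ := h.exists_eq
    simp [IsDisjoint]

variable {x y : Word n}

theorem equivalent (h : CyclicPair (ops x) (ops y)) : Equivalent (x : WithZero (Word n)) y :=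
  equivalent_iff.2 h.sameAction

theorem not_equivalent_zero (h : CyclicPair (ops x) (ops y)) :
    ¬ Equivalent (x : WithZero (Word n)) 0 :=
  not_equivalent_zero_iff.2 h.exists_run

theorem equivDegree_eq (h : CyclicPair (ops x) (ops y)) :
    equivDegree (x : WithZero (Word n)) y = 3 := by
  change max x.length y.length = 3
  rw [← length_ops, ← length_ops, h.length_eq.1, h.length_eq.2, max_self]

end CyclicPair

variable {x y z : Word n}

theorem Equivalent.rearranged_or_cyclicPair (h : Equivalent (x : WithZero (Word n)) y)
    (h0 : ¬ Equivalent (x : WithZero (Word n)) 0) (hx : x.length = 3) :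
    Rearranged (ops x) (ops y) ∨ CyclicPair (ops x) (ops y) ∨ CyclicPair (ops y) (ops x) := by
  have hy := h.length_eq h0
  obtain ⟨k, p, hp⟩ := not_equivalent_zero_iff.1 h0
  exact QuantumBruhat.rearranged_or_cyclicPair (equivalent_iff.1 h k p (.inl hp))
    (by rw [length_ops, hx]) (by rw [length_ops, ← hy, hx])

theorem CyclicPair.eq_of_equivalent (h : CyclicPair (ops x) (ops y))
    (he : Equivalent (x : WithZero (Word n)) z)
    (hs : (ops x).head? = (ops z).head? ∨ (ops x).getLast? = (ops z).getLast?) : z = x := by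
  rcases he.rearranged_or_cyclicPair h.not_equivalent_zero (length_ops x ▸ h.length_eq.1) with
    h' | h' | h'
  · exact ops_injective (h'.eq_of_isChain h.isChain)
  · exact absurd hs (not_or.2 ⟨h'.head?_ne, h'.getLast?_ne⟩)
  · exact absurd hs (not_or.2 ⟨h'.head?_ne.symm, h'.getLast?_ne.symm⟩)

/-- The syntactic congruence of an element `x` of a monoid: the coarsest congruence in which `x` is
alone in its class. -/
def syntacticCon {M : Type*} [Monoid M] (x : M) : Con M where
  r p q := ∀ s t, s * p * t = x ↔ s * q * t = x
  iseqv := ⟨fun _ _ _ => Iff.rfl, fun h s t => (h s t).symm, fun h h' s t => (h s t).trans (h' s t)⟩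
  mul' {p q p' q'} h h' s t := by
    have left := h s (p' * t)
    have right := h' (s * q) t
    simp only [mul_assoc] at left right ⊢
    exact left.trans right

theorem CyclicPair.mul_mul_eq (h : CyclicPair (ops x) (ops y)) {p q s t : WithZero (Word n)}
    (he : Equivalent p q) (hd : degree p < 3) (hx : s * p * t = x) : s * q * t = x := by
  have he' : Equivalent (x : WithZero (Word n)) (s * q * t) := hx ▸ he.mul_mul s t
  rcases s with _ | s
  · cases hx
  rcases p with _ | p
  · cases hx
  rcases t with _ | t
  · cases hx
  rcases q with _ | q
  · exact absurd he' h.not_equivalent_zero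
  obtain rfl : s * p * t = x := WithZero.coe_inj.1 hx
  refine WithZero.coe_inj.2 (h.eq_of_equivalent he' ?_)
  have ops_mul (w w' : Word n) : ops (w * w') = ops w' ++ ops w := by simp [ops]
  have length_eq := h.length_eq.1
  replace hd : (ops p).length < 3 := by rwa [length_ops]
  simp only [ops_mul, List.length_append] at length_eq ⊢
  rcases ht : ops t with _ | ⟨o, l⟩
  · have hs : ops s ≠ [] := by
      intro hs
      rw [ht, hs, List.length_nil] at length_eq
      omega
    exact .inr (by simp only [List.nil_append, List.getLast?_append_of_ne_nil _ hs])
  · exact .inl rfl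

theorem CyclicPair.lowerCon_le_syntacticCon (h : CyclicPair (ops x) (ops y)) :
    lowerCon n 3 ≤ syntacticCon (x : WithZero (Word n)) :=
  Con.conGen_le.2 fun _ _ ⟨he, hd⟩ _ _ =>
    ⟨h.mul_mul_eq he (max_lt_iff.1 hd).1, h.mul_mul_eq he.symm (max_lt_iff.1 hd).2⟩

theorem CyclicPair.not_lowerCon (h : CyclicPair (ops x) (ops y)) :
    ¬ lowerCon n 3 (x : WithZero (Word n)) y := by
  intro hc
  have y_eq := (h.lowerCon_le_syntacticCon hc 1 1).1 (by rw [one_mul, mul_one])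
  rw [one_mul, mul_one, WithZero.coe_inj] at y_eq
  exact h.head?_ne (by rw [y_eq])

theorem CyclicPair.isMinimalEquiv (h : CyclicPair (ops x) (ops y)) :
    IsMinimalEquiv (x : WithZero (Word n)) y :=
  ⟨h.equivalent, h.equivDegree_eq.symm ▸ h.not_lowerCon⟩

theorem IsMinimalEquiv.cyclicPair (h : IsMinimalEquiv (x : WithZero (Word n)) y)
    (h0 : ¬ Equivalent (x : WithZero (Word n)) 0) (hd : equivDegree (x : WithZero (Word n)) y = 3) :
    CyclicPair (ops x) (ops y) ∨ CyclicPair (ops y) (ops x) := by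
  have length_eq := h.1.length_eq h0
  have max_eq : max x.length y.length = 3 := hd
  refine (h.1.rearranged_or_cyclicPair h0 (by omega)).resolve_left fun hr => h.2 ?_
  rw [hd]
  exact lowerCon_of_rearranged_ops hr

end Minimality

end QuantumBruhat

theorem mainTheorem2 (n : ℕ) (x y : QuantumBruhat.Word n) :
    (¬ QuantumBruhat.Equivalent (x : WithZero (QuantumBruhat.Word n)) 0 ∧
      QuantumBruhat.equivDegree (x : WithZero (QuantumBruhat.Word n)) y = 3 ∧
      QuantumBruhat.IsMinimalEquiv (x : WithZero (QuantumBruhat.Word n)) y) ↔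
    (QuantumBruhat.Listed x y ∨ QuantumBruhat.Listed y x) := by
  simp only [QuantumBruhat.listed_iff_cyclicPair]
  constructor
  · rintro ⟨h0, hd, h⟩
    exact h.cyclicPair h0 hd
  · rintro (h | h)
    · exact ⟨h.not_equivalent_zero, h.equivDegree_eq, h.isMinimalEquiv⟩
    · refine ⟨fun h0 => h.not_equivalent_zero (h.equivalent.trans h0), ?_, h.isMinimalEquiv.symm⟩
      rw [QuantumBruhat.equivDegree, max_comm]
      exact h.equivDegree_eq
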